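/- Let $\mathscr H$ be a separable complex Hilbert space, $\mathscr M\subset\mathscr B(\mathscr H)$ a von Neumann algebra and $\rho$ a faithful normal semifinite trace on $\mathscr M$. Assume that either $\mathscr M$ is atomic (generated as a von Neumann algebra by its minimal projections), or $\mathscr M$ is diffuse (has no minimal projections) and $\rho(I)=\infty$. Let $Proj(\mathscr M)$ be the set of selfadjoint projections of $\mathscr M$, $\mathscr P=\{P\in Proj(\mathscr M): \rho(P)<\infty\}$, $\mathscr R=\{x\in\mathscr M: xP=x \text{ for some } P\in\mathscr P\}$ and $\mathscr R_1^+=\{a\in\mathscr R: 0\le a\le I\}$. For $t>0$ and $x\in\mathscr M$ let $\mu(t,x)=\inf\{\|x(I-P)\| : P\in\mathscr P,\ \rho(P)\le t\}$, and put $|x|_1=\rho((x^*x)^{1/2})$. Let $|\cdot|_{\mathscr J}$ be a norm on $L^1(\mathscr M,\rho)\cap\mathscr M=\{x\in\mathscr M:|x|_1<\infty\}$ such that 1. if $\mu(t,x)\le\mu(t,y)$ for all $t>0$, then $|x|_{\mathscr J}\le|y|_{\mathscr J}$; 2. there are constants $C_1,C_2\in(0,\infty)$ with $C_1\min(|x|_1,\|x\|)\le|x|_{\mathscr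 J}\le C_2(|x|_1+\|x\|)$ for all $x$; 3. if $P_m\in\mathscr P$ and $\rho(P_m)\to0$, then $|P_m|_{\mathscr J}\to0$. Let $\tau=(T_j)_{1\le j\le n}$ be an $n$-tuple of elements of $\mathscr M$, and let $\alpha=(\alpha_j)_{1\le j\le n}$ be an $n$-tuple of $*$-automorphisms of $\mathscr M$ which preserve $\rho$. For $P\in\mathscr P$ set $$k_{\mathscr J}(\tau;P)=\inf\{\max_{1\le j\le n}|[T_j,A]|_{\mathscr J} : A\in\mathscr R_1^+,\ AP=P\},$$ $$k_{\mathscr J}(\alpha;P)=\inf\{\max_{1\le j\le n}|\alpha_j(A)-A|_{\mathscr J} : A\in\mathscr R_1^+,\ AP=P\},$$ and for $P\in Proj(\mathscr M)$ set $k_{\mathscr J}(\cdot\,;P)=\sup\{k_{\mathscr J}(\cdot\,;P') : P'\in\mathscr P,\ P'\le P\}\in[0,\infty]$. Then there is a unique projection $E^0_{\mathscr J}(\tau)\in Proj(\mathscr M)$ such that, for every $P\in Proj(\mathscr M)$, $k_{\mathscr J}(\tau;P)=0$ if and only if $P\le E^0_{\mathscr J}(\tau)$; likewise there is a unique projection $E^0_{\mathscr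 J}(\alpha)\in Proj(\mathscr M)$ such that, for every $P\in Proj(\mathscr M)$, $k_{\mathscr J}(\alpha;P)=0$ if and only if $P\le E^0_{\mathscr J}(\alpha)$. Put $E_{\mathscr J}(\tau)=I-E^0_{\mathscr J}(\tau)$ and $E_{\mathscr J}(\alpha)=I-E^0_{\mathscr J}(\alpha)$ (the $\mathscr J$-regular projections). (a) If $A_m=A_m^*\in\mathscr R$ $(m\in\mathbb N)$ satisfy $\|A_m\|\le C$ for all $m$ and some constant $C$, and $\lim_{m\to\infty}\max_{1\le j\le n}|[A_m,T_j]|_{\mathscr J}=0$, then $A_mE_{\mathscr J}(\tau)\to0$ strongly as $m\to\infty$. (b) If $A_m=A_m^*\in\mathscr R$ $(m\in\mathbb N)$ satisfy $\|A_m\|\le C$ for all $m$ and some constant $C$, and $\lim_{m\to\infty}\max_{1\le j\le n}|\alpha_j(A_m)-A_m|_{\mathscr J}=0$, then $A_mE_{\mathscr J}(\alpha)\to0$ strongly as $m\to\infty$. -/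

import Mathlib

open Filter Topology
open scoped ENNReal

noncomputable section

namespace SemifiniteModulus

variable {H : Type*} [NormedAddCommGroup H] [InnerProductSpace ℂ H] [CompleteSpace H]

/-- A faithful normal semifinite trace `ρ : M₊ → [0, ∞]` on a von Neumann algebra `M ⊆ B(H)`.
Only the values of `ρ` on the positive cone of `M` are constrained, and only these are ever used.
The order on `B(H)` is the Loewner order. -/
structure IsFaithfulNormalSemifiniteTrace (M : VonNeumannAlgebra H)
    (ρ : (H →L[ℂ] H) → ℝ≥0∞) : Prop where
  map_add : ∀ a ∈ M, ∀ b ∈ M, 0 ≤ a → 0 ≤ b → ρ (a + b) = ρ a + ρ b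
  map_smul : ∀ c : ℝ, 0 ≤ c → ∀ a ∈ M, 0 ≤ a → ρ ((c : ℂ) • a) = ENNReal.ofReal c * ρ a
  trace : ∀ x ∈ M, ρ (star x * x) = ρ (x * star x)
  faithful : ∀ a ∈ M, 0 ≤ a → ρ a = 0 → a = 0
  /-- `ρ` preserves suprema of bounded increasing nets in `M₊`. -/
  normal : ∀ S : Set (H →L[ℂ] H), S ⊆ M → (∀ a ∈ S, 0 ≤ a) → S.Nonempty →
    DirectedOn (· ≤ ·) S → ∀ b ∈ M, IsLUB S b → ρ b = ⨆ a ∈ S, ρ a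
  semifinite : ∀ a ∈ M, 0 ≤ a → a ≠ 0 → ∃ b ∈ M, 0 ≤ b ∧ b ≤ a ∧ b ≠ 0 ∧ ρ b < ∞

/-- `Proj(M)`: the selfadjoint projections of `M`. -/
def Proj (M : VonNeumannAlgebra H) : Set (H →L[ℂ] H) :=
  {P | P ∈ M ∧ IsStarProjection P}

/-- `P` is a minimal projection of `M`. -/
def IsMinimalProjection (M : VonNeumannAlgebra H) (P : H →L[ℂ] H) : Prop :=
  P ∈ Proj M ∧ P ≠ 0 ∧ ∀ Q ∈ Proj M, Q ≤ P → Q = 0 ∨ Q = P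

/-- `M` is generated, as a von Neumann algebra, by its minimal projections (the von Neumann
algebra generated by a selfadjoint set is its double commutant). -/
def IsAtomic (M : VonNeumannAlgebra H) : Prop :=
  Set.centralizer (Set.centralizer {P | IsMinimalProjection M P}) = (M : Set (H →L[ℂ] H))

/-- `M` has no minimal projections. -/
def IsDiffuse (M : VonNeumannAlgebra H) : Prop :=
  ∀ P, ¬ IsMinimalProjection M P

/-- `𝒫(M)`: the projections of `M` of finite trace. -/
def FinProj (M : VonNeumannAlgebra H) (ρ : (H →L[ℂ] H) → ℝ≥0∞) : Set (H →L[ℂ] H) :=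
  {P | P ∈ Proj M ∧ ρ P < ∞}

/-- `ℛ`: the operators of finite `ρ`-rank, that is the `x ∈ M` with `x P = x` for some projection
`P ∈ M` of finite trace. -/
def FinRank (M : VonNeumannAlgebra H) (ρ : (H →L[ℂ] H) → ℝ≥0∞) : Set (H →L[ℂ] H) :=
  {x | x ∈ M ∧ ∃ P ∈ FinProj M ρ, x * P = x}

/-- `ℛ₁⁺`: the positive contractions of finite `ρ`-rank. -/
def FinRankPosContraction (M : VonNeumannAlgebra H) (ρ : (H →L[ℂ] H) → ℝ≥0∞) :
    Set (H →L[ℂ] H) :=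
  {a | a ∈ FinRank M ρ ∧ 0 ≤ a ∧ a ≤ 1}

/-- `L¹(M, ρ) ∩ M`, the `x ∈ M` with `ρ(|x|) < ∞`, where `|x| = (x* x)^{1/2}`. -/
def L1Inter (M : VonNeumannAlgebra H) (ρ : (H →L[ℂ] H) → ℝ≥0∞) : Set (H →L[ℂ] H) :=
  {x | x ∈ M ∧ ρ (CFC.abs x) < ∞}

/-- The trace norm `|x|₁ = ρ(|x|)` of `x ∈ L¹(M, ρ) ∩ M`. -/
def norm1 (ρ : (H →L[ℂ] H) → ℝ≥0∞) (x : H →L[ℂ] H) : ℝ :=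
  (ρ (CFC.abs x)).toReal

/-- The generalized singular values `μ(t, x) = inf {‖x (1 - P)‖ : P ∈ 𝒫(M), ρ(P) ≤ t}`. -/
def singularValue (M : VonNeumannAlgebra H) (ρ : (H →L[ℂ] H) → ℝ≥0∞) (t : ℝ)
    (x : H →L[ℂ] H) : ℝ :=
  sInf {r | ∃ P ∈ FinProj M ρ, ρ P ≤ ENNReal.ofReal t ∧ r = ‖x * (1 - P)‖}

/-- `N = |·|_J` is a symmetric operator norm on `L¹(M, ρ) ∩ M`. Only the values of `N` on
`L¹(M, ρ) ∩ M` are constrained. -/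
structure IsSymmetricOperatorNorm (M : VonNeumannAlgebra H) (ρ : (H →L[ℂ] H) → ℝ≥0∞)
    (N : (H →L[ℂ] H) → ℝ) : Prop where
  add_le : ∀ x ∈ L1Inter M ρ, ∀ y ∈ L1Inter M ρ, N (x + y) ≤ N x + N y
  smul_eq : ∀ c : ℂ, ∀ x ∈ L1Inter M ρ, N (c • x) = ‖c‖ * N x
  eq_zero : ∀ x ∈ L1Inter M ρ, N x = 0 → x = 0
  /-- Monotonicity in the generalized singular values. -/
  mono : ∀ x ∈ L1Inter M ρ, ∀ y ∈ L1Inter M ρ,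
    (∀ t : ℝ, 0 < t → singularValue M ρ t x ≤ singularValue M ρ t y) → N x ≤ N y
  /-- Comparison with the trace norm and the operator norm. -/
  bounds : ∃ C₁ C₂ : ℝ, 0 < C₁ ∧ 0 < C₂ ∧ ∀ x ∈ L1Inter M ρ,
    C₁ * min (norm1 ρ x) ‖x‖ ≤ N x ∧ N x ≤ C₂ * (norm1 ρ x + ‖x‖)
  /-- Projections of small trace have small norm. -/
  tendsto_proj : ∀ P : ℕ → (H →L[ℂ] H), (∀ m, P m ∈ FinProj M ρ) →
    Tendsto (fun m => ρ (P m)) atTop (𝓝 0) → Tendsto (fun m => N (P m)) atTop (𝓝 0)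

/-- The commutators `A ↦ [T_j, A]`, `1 ≤ j ≤ n`. -/
def commDiff (M : VonNeumannAlgebra H) {n : ℕ} (T : Fin n → M.toStarSubalgebra) :
    Fin n → M.toStarSubalgebra → (H →L[ℂ] H) :=
  fun j A => T j * A - A * T j

/-- The differences `A ↦ α_j(A) - A`, `1 ≤ j ≤ n`. -/
def autDiff (M : VonNeumannAlgebra H) {n : ℕ}
    (α : Fin n → (M.toStarSubalgebra ≃⋆ₐ[ℂ] M.toStarSubalgebra)) :
    Fin n → M.toStarSubalgebra → (H →L[ℂ] H) :=
  fun j A => α j A - A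

/-- The condenser quasicentral modulus for projections `P, Q` of finite trace with `P Q = 0`:
the infimum of `max_j |D_j(A)|_J` over `A ∈ ℛ₁⁺` with `A P = P`, `A Q = 0`. Here `D` is
`commDiff M T` for an `n`-tuple of operators and `autDiff M α` for one of automorphisms. -/
def condenserModulusFin (M : VonNeumannAlgebra H) (ρ : (H →L[ℂ] H) → ℝ≥0∞)
    (N : (H →L[ℂ] H) → ℝ) {n : ℕ} (D : Fin n → M.toStarSubalgebra → (H →L[ℂ] H))
    (P Q : H →L[ℂ] H) : ℝ≥0∞ :=
  ⨅ (A : M.toStarSubalgebra) (_ : (A : H →L[ℂ] H) ∈ FinRankPosContraction M ρ ∧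
    (A : H →L[ℂ] H) * P = P ∧ (A : H →L[ℂ] H) * Q = 0), ⨆ j, ENNReal.ofReal (N (D j A))

/-- The condenser quasicentral modulus for arbitrary projections `P, Q ∈ M` with `P Q = 0`. -/
def condenserModulus (M : VonNeumannAlgebra H) (ρ : (H →L[ℂ] H) → ℝ≥0∞)
    (N : (H →L[ℂ] H) → ℝ) {n : ℕ} (D : Fin n → M.toStarSubalgebra → (H →L[ℂ] H))
    (P Q : H →L[ℂ] H) : ℝ≥0∞ :=
  ⨆ (P' ∈ FinProj M ρ) (Q' ∈ FinProj M ρ) (_ : P' ≤ P ∧ Q' ≤ Q),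
    condenserModulusFin M ρ N D P' Q'

/-- The quasicentral modulus of a projection `P`: `k_J(P) = k_J(P, 0)`. -/
def modulus (M : VonNeumannAlgebra H) (ρ : (H →L[ℂ] H) → ℝ≥0∞)
    (N : (H →L[ℂ] H) → ℝ) {n : ℕ} (D : Fin n → M.toStarSubalgebra → (H →L[ℂ] H))
    (P : H →L[ℂ] H) : ℝ≥0∞ :=
  condenserModulus M ρ N D P 0

/-- `E₀` is the `J`-singular projection: for projections `P ∈ M`, `k_J(P) = 0` iff `P ≤ E₀`.
The `J`-regular projection is then `1 - E₀`. -/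
def IsSingularProjection (M : VonNeumannAlgebra H) (ρ : (H →L[ℂ] H) → ℝ≥0∞)
    (N : (H →L[ℂ] H) → ℝ) {n : ℕ} (D : Fin n → M.toStarSubalgebra → (H →L[ℂ] H))
    (E₀ : H →L[ℂ] H) : Prop :=
  E₀ ∈ Proj M ∧ ∀ P ∈ Proj M, modulus M ρ N D P = 0 ↔ P ≤ E₀

end SemifiniteModulus

end

noncomputable section

namespace SemifiniteModulus

set_option linter.unusedSectionVars false

section

variable {H : Type*} [NormedAddCommGroup H] [InnerProductSpace ℂ H] [CompleteSpace H]

/-! ### Order and projections in `B(H)` -/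

/-! Commutators and automorphism differences are treated together: both are linear maps with `d (xy)
= d x * β y + x * d y`, where `β` is a contractive unital multiplicative map (the identity,
respectively `α`). This is `IsTwistedDerivation`.

Let `W` be the set `weakInvariant` of weak operator limits of positive finite rank contractions
whose differences tend to zero in the norm `N`. It is convex and weakly closed. Convexity upgrades
weak to strong approximation (`exists_strong_approx`), resolvents are strongly continuous, and the
Leibniz rule controls `d` of a resolvent. Hence `W` is stable under `X ↦ X (X + l)⁻¹` and contains
the support of each of its elements. Supports of midpoints make the projections in `W` directed;
their supremum `E` lies in `W` and satisfies `E X = X` for all `X ∈ W`.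

This `E` is the singular projection. If a finite projection `P'` has modulus zero, a weak limit of
near minimizers is some `X ∈ W` with `X P' = P'`, so `P' ≤ E`; semifiniteness passes from finite
subprojections to all projections. Conversely, for `P' ≤ E` finite, some almost invariant `A` is
strongly close to the identity on finitely many vectors of the range of `P'`. Normality of the trace
and smallness of `N` on projections of small trace then make `(1 - A) P'` small in `N`
(`exists_finset_apply_mul_le`), so replacing `A` by `P' + (1 - P') A (1 - P')` costs little.

For the convergence statement, suitably rescaled squares `A_m²` are again asymptotically invariant
by the Leibniz rule. Their weak limits along ultrafilters lie in `W`, hence vanish on the range of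
`1 - E`, and `‖A_m η‖² = ⟨A_m² η, η⟩`. -/

lemma nonneg_iff_re_inner (a : H →L[ℂ] H) :
    0 ≤ a ↔ IsSelfAdjoint a ∧ ∀ ξ, 0 ≤ (inner ℂ (a ξ) ξ).re := by
  rw [ContinuousLinearMap.nonneg_iff_isPositive, ContinuousLinearMap.isPositive_def']
  rfl

lemma re_inner_nonneg {a : H →L[ℂ] H} (ha : 0 ≤ a) (ξ : H) : 0 ≤ (inner ℂ (a ξ) ξ).re :=
  ((nonneg_iff_re_inner a).1 ha).2 ξ

lemma re_inner_mono {a b : H →L[ℂ] H} (h : a ≤ b) (ξ : H) :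
    (inner ℂ (a ξ) ξ).re ≤ (inner ℂ (b ξ) ξ).re := by
  have := re_inner_nonneg (sub_nonneg.2 h) ξ
  simp only [sub_apply, inner_sub_left, Complex.sub_re] at this
  linarith

lemma inner_star_apply (a : H →L[ℂ] H) (ξ η : H) :
    inner ℂ (a ξ) η = inner ℂ ξ ((star a) η) := by
  rw [ContinuousLinearMap.star_eq_adjoint, ContinuousLinearMap.adjoint_inner_right]

lemma re_inner_star_mul_self (a : H →L[ℂ] H) (ξ : H) :
    (inner ℂ ((star a * a) ξ) ξ).re = ‖a ξ‖ ^ 2 := by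
  rw [mul_apply_eq_comp, inner_star_apply, star_star]
  exact (norm_sq_eq_re_inner (𝕜 := ℂ) (a ξ)).symm

lemma smul_nonneg_real {c : ℝ} (hc : 0 ≤ c) {a : H →L[ℂ] H} (ha : 0 ≤ a) : 0 ≤ c • a :=
  smul_nonneg hc ha

/-- If `a ≥ 0` and `x a x* = 0` then `x a = 0`. -/
lemma mul_eq_zero_of_conj {a x : H →L[ℂ] H} (ha : 0 ≤ a) (h : x * a * star x = 0) :
    x * a = 0 := by
  obtain ⟨s, rfl⟩ := CStarAlgebra.nonneg_iff_eq_star_mul_self.1 ha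
  have h1 : s * star x = 0 := by
    rw [← CStarRing.star_mul_self_eq_zero_iff]
    simpa [mul_assoc] using h
  have h2 : x * star s = 0 := by simpa using congrArg star h1
  rw [← mul_assoc, h2, zero_mul]

/-- If `0 ≤ a ≤ b` and `x b = 0` then `x a = 0`. -/
lemma mul_eq_zero_of_le {a b x : H →L[ℂ] H} (ha : 0 ≤ a) (hab : a ≤ b) (h : x * b = 0) :
    x * a = 0 := by
  apply mul_eq_zero_of_conj ha
  apply le_antisymm
  · simpa [h] using star_right_conjugate_le_conjugate hab x
  · exact star_right_conjugate_nonneg ha x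

lemma proj_mul_self {p : H →L[ℂ] H} (hp : IsStarProjection p) : p * p = p :=
  hp.isIdempotentElem

lemma proj_star {p : H →L[ℂ] H} (hp : IsStarProjection p) : star p = p :=
  hp.isSelfAdjoint

/-- If a projection `p` is below a contraction `a ≥ 0`, then `a p = p`. -/
lemma mul_proj_of_le {a p : H →L[ℂ] H} (ha1 : a ≤ 1) (hp : IsStarProjection p)
    (hpa : p ≤ a) : a * p = p := by
  have h : p * (1 - a) = 0 := by
    apply mul_eq_zero_of_le (sub_nonneg.2 ha1) (b := 1 - p)
    · exact sub_le_sub_left hpa 1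
    · rw [mul_sub, mul_one, proj_mul_self hp, sub_self]
  have h2 : p * a = p := by rw [mul_sub, mul_one, sub_eq_zero] at h; exact h.symm
  have hsa : star a = a := (IsSelfAdjoint.of_nonneg (hp.nonneg.trans hpa)).star_eq
  simpa [hsa, proj_star hp] using congrArg star h2

/-- If `a ≥ 0` satisfies `a p = p` then `p ≤ a`. -/
lemma proj_le_of_mul {a p : H →L[ℂ] H} (ha : 0 ≤ a) (hp : IsStarProjection p)
    (h : a * p = p) : p ≤ a := by
  have h' : p * a = p := by
    simpa [(IsSelfAdjoint.of_nonneg ha).star_eq, proj_star hp] using congrArg star h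
  have : a - p = star (1 - p) * a * (1 - p) := by
    simp only [star_sub, star_one, proj_star hp, sub_mul, mul_sub, one_mul, mul_one, h, h',
      proj_mul_self hp]
    abel
  rw [← sub_nonneg, this]
  exact star_left_conjugate_nonneg ha _

/-- For `0 ≤ a ≤ c p` one has `a p = a`. -/
lemma mul_proj_of_le_smul {a p : H →L[ℂ] H} {c : ℝ} (ha : 0 ≤ a) (hp : IsStarProjection p)
    (h : a ≤ c • p) : a * p = a := by
  have h0 : (1 - p) * a = 0 := by
    apply mul_eq_zero_of_le ha h
    rw [mul_smul_comm, sub_mul, one_mul, proj_mul_self hp, sub_self, smul_zero]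
  have h2 : p * a = a := by rw [sub_mul, one_mul, sub_eq_zero] at h0; exact h0.symm
  simpa [(IsSelfAdjoint.of_nonneg ha).star_eq, proj_star hp] using congrArg star h2

lemma proj_mul_comm_left {a p : H →L[ℂ] H} (ha : IsSelfAdjoint a) (hp : IsStarProjection p)
    (h : a * p = a) : p * a = a := by
  simpa [ha.star_eq, proj_star hp] using congrArg star h

lemma le_smul_one (a : H →L[ℂ] H) (ha : IsSelfAdjoint a) : a ≤ ‖a‖ • (1 : H →L[ℂ] H) := by
  simpa [Algebra.algebraMap_eq_smul_one] using ha.le_algebraMap_norm_self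

lemma le_one_of_norm_le {a : H →L[ℂ] H} (ha : 0 ≤ a) (h : ‖a‖ ≤ 1) : a ≤ 1 :=
  (CStarAlgebra.norm_le_one_iff_of_nonneg a ha).1 h

lemma norm_le_one_of_le {a : H →L[ℂ] H} (ha : 0 ≤ a) (h : a ≤ 1) : ‖a‖ ≤ 1 :=
  (CStarAlgebra.norm_le_one_iff_of_nonneg a ha).2 h

lemma norm_le_of_le_smul_one {a : H →L[ℂ] H} {c : ℝ} (hc : 0 ≤ c) (ha : 0 ≤ a)
    (h : a ≤ c • (1 : H →L[ℂ] H)) : ‖a‖ ≤ c :=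
  (CStarAlgebra.norm_le_iff_le_algebraMap a hc ha).2
    (by simpa [Algebra.algebraMap_eq_smul_one] using h)

/-- A positive `a` with `a p = a`, `p` a projection, is dominated by `‖a‖ p`. -/
lemma le_norm_smul_proj {a p : H →L[ℂ] H} (ha : 0 ≤ a) (hp : IsStarProjection p)
    (h : a * p = a) : a ≤ ‖a‖ • p := by
  have h1 := star_left_conjugate_le_conjugate (le_smul_one a (IsSelfAdjoint.of_nonneg ha)) p
  have h2 := proj_mul_comm_left (IsSelfAdjoint.of_nonneg ha) hp h
  rw [proj_star hp, h2, h, mul_smul_comm, mul_one, smul_mul_assoc, proj_mul_self hp] at h1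
  exact h1

lemma norm_proj_le {p : H →L[ℂ] H} (hp : IsStarProjection p) : ‖p‖ ≤ 1 :=
  norm_le_one_of_le hp.nonneg hp.le_one

/-! ### Weak operator limits -/

/-- `A` converges to `X` in the weak operator topology along `l`. -/
def WeakLim {ι : Type*} (l : Filter ι) (A : ι → (H →L[ℂ] H)) (X : H →L[ℂ] H) : Prop :=
  ∀ ξ η : H, Tendsto (fun i => (inner ℂ (A i ξ) η : ℂ)) l (𝓝 (inner ℂ (X ξ) η))

namespace WeakLim

variable {ι : Type*} {l : Filter ι} {A B : ι → (H →L[ℂ] H)} {X Y : H →L[ℂ] H}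

lemma of_tendsto (h : Tendsto A l (𝓝 X)) : WeakLim l A X := fun ξ η => by
  have h1 : Tendsto (fun i => A i ξ) l (𝓝 (X ξ)) :=
    ((ContinuousLinearMap.apply ℂ H ξ).continuous.tendsto X).comp h
  exact h1.inner tendsto_const_nhds

lemma const (X : H →L[ℂ] H) : WeakLim l (fun _ => X) X := fun _ _ => tendsto_const_nhds

lemma sub (hA : WeakLim l A X) (hB : WeakLim l B Y) :
    WeakLim l (fun i => A i - B i) (X - Y) := fun ξ η => by
  simpa [inner_sub_left] using (hA ξ η).sub (hB ξ η)

lemma const_mul (hA : WeakLim l A X) (b : H →L[ℂ] H) :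
    WeakLim l (fun i => b * A i) (b * X) := fun ξ η => by
  simp only [mul_apply_eq_comp, inner_star_apply b]
  exact hA ξ _

lemma mul_const (hA : WeakLim l A X) (b : H →L[ℂ] H) :
    WeakLim l (fun i => A i * b) (X * b) := fun ξ η => hA (b ξ) η

lemma unique [l.NeBot] (hA : WeakLim l A X) (hB : WeakLim l A Y) : X = Y :=
  ContinuousLinearMap.ext fun ξ => ext_inner_right ℂ fun η =>
    tendsto_nhds_unique (hA ξ η) (hB ξ η)

lemma congr (hA : WeakLim l A X) (h : ∀ᶠ i in l, A i = B i) : WeakLim l B X := fun ξ η =>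
  (hA ξ η).congr' (h.mono fun i hi => by simp only [hi])

lemma eq_const [l.NeBot] (hA : WeakLim l A X) (h : ∀ᶠ i in l, A i = Y) : X = Y :=
  (hA.congr (B := fun _ => Y) h).unique (const Y)

lemma star (hA : WeakLim l A X) : WeakLim l (fun i => star (A i)) (star X) := fun ξ η => by
  simp only [inner_star_apply (Star.star _), star_star]
  simp_rw [← inner_conj_symm ξ]
  exact ((Complex.continuous_conj.tendsto _).comp (hA η ξ))

lemma nonneg [l.NeBot] (hA : WeakLim l A X) (h : ∀ᶠ i in l, 0 ≤ A i) : 0 ≤ X := by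
  rw [nonneg_iff_re_inner]
  refine ⟨?_, fun ξ => ?_⟩
  · exact (hA.star.congr (h.mono fun i hi => (IsSelfAdjoint.of_nonneg hi).star_eq)).unique hA
  · exact ge_of_tendsto ((Complex.continuous_re.tendsto _).comp (hA ξ ξ))
      (h.mono fun i hi => re_inner_nonneg hi ξ)

lemma le_const [l.NeBot] (hA : WeakLim l A X) (h : ∀ᶠ i in l, A i ≤ Y) : X ≤ Y :=
  sub_nonneg.1 (((const Y).sub hA).nonneg (h.mono fun _ hi => sub_nonneg.2 hi))

lemma const_le [l.NeBot] (hA : WeakLim l A X) (h : ∀ᶠ i in l, Y ≤ A i) : Y ≤ X :=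
  sub_nonneg.1 ((hA.sub (const Y)).nonneg (h.mono fun _ hi => sub_nonneg.2 hi))

lemma re_inner (hA : WeakLim l A X) (ξ : H) :
    Tendsto (fun i => (inner ℂ (A i ξ) ξ : ℂ).re) l (𝓝 (inner ℂ (X ξ) ξ : ℂ).re) :=
  (Complex.continuous_re.tendsto _).comp (hA ξ ξ)

end WeakLim

/-- Bounded families have weak operator limits along ultrafilters. -/
lemma exists_weakLim {ι : Type*} (u : Ultrafilter ι) (A : ι → (H →L[ℂ] H)) {C : ℝ}
    (hA : ∀ i, ‖A i‖ ≤ C) : ∃ X, WeakLim (u : Filter ι) A X := by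
  have hb : ∀ ξ η i, ‖(inner ℂ (A i ξ) η : ℂ)‖ ≤ C * ‖ξ‖ * ‖η‖ := fun ξ η i =>
    (norm_inner_le_norm _ _).trans (mul_le_mul_of_nonneg_right
      ((A i).le_of_opNorm_le (hA i) ξ) (norm_nonneg _))
  have hlim : ∀ ξ η, ∃ z : ℂ, ‖z‖ ≤ C * ‖ξ‖ * ‖η‖ ∧
      Tendsto (fun i => (inner ℂ (A i ξ) η : ℂ)) u (𝓝 z) := fun ξ η => by
    obtain ⟨z, hz, hz'⟩ := (isCompact_closedBall (0 : ℂ) (C * ‖ξ‖ * ‖η‖)).ultrafilter_le_nhds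
      (u.map fun i => (inner ℂ (A i ξ) η : ℂ)) (by
        rw [le_principal_iff]
        exact Filter.Eventually.of_forall (f := (u : Filter ι)) fun i => by simpa using hb ξ η i)
    exact ⟨z, by simpa using hz, hz'⟩
  choose f hf hlim using hlim
  -- Uniqueness of limits makes the limit form sesquilinear and `C` bounds it, so the Riesz theorem
  -- represents it by an operator.
  let B : H →L⋆[ℂ] H →L[ℂ] ℂ := LinearMap.mkContinuous₂
    (LinearMap.mk₂'ₛₗ (starRingEnd ℂ) (RingHom.id ℂ) f
      (fun a b c => tendsto_nhds_unique (hlim _ _) (by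
        simpa [inner_add_left] using (hlim a c).add (hlim b c)))
      (fun a b c => tendsto_nhds_unique (hlim _ _) (by
        simpa [inner_smul_left, mul_comm] using (hlim b c).const_mul ((starRingEnd ℂ) a)))
      (fun a b c => tendsto_nhds_unique (hlim _ _) (by
        simpa [inner_add_right] using (hlim a b).add (hlim a c)))
      (fun a b c => tendsto_nhds_unique (hlim _ _) (by
        simpa [inner_smul_right] using (hlim b c).const_mul a))) C hf
  refine ⟨InnerProductSpace.continuousLinearMapOfBilin B, fun ξ η => ?_⟩
  rw [InnerProductSpace.continuousLinearMapOfBilin_apply]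
  exact hlim ξ η

/-- A bounded increasing family has a weak limit along any ultrafilter finer than `atTop`, which
is its least upper bound. -/
lemma exists_weakLim_of_monotone {ι : Type*} [Preorder ι] [IsDirectedOrder ι] [Nonempty ι]
    (A : ι → (H →L[ℂ] H)) (hm : Monotone A) (h0 : ∀ i, 0 ≤ A i) (h1 : ∀ i, A i ≤ 1) :
    ∃ (u : Ultrafilter ι) (X : H →L[ℂ] H), (u : Filter ι) ≤ atTop ∧ WeakLim (u : Filter ι) A X ∧
      (∀ i, A i ≤ X) ∧ IsLUB (Set.range A) X := by
  obtain ⟨X, hX⟩ := exists_weakLim (Ultrafilter.of (atTop : Filter ι)) A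
    (fun i => norm_le_one_of_le (h0 i) (h1 i))
  have hu := Ultrafilter.of_le (atTop : Filter ι)
  have hub : ∀ i, A i ≤ X := fun i => hX.const_le (hu ((eventually_ge_atTop i).mono
    fun j hj => hm hj))
  refine ⟨_, X, hu, hX, hub, ?_, ?_⟩
  · rintro _ ⟨i, rfl⟩
    exact hub i
  · intro Y hY
    exact hX.le_const (Eventually.of_forall fun i => hY ⟨i, rfl⟩)

/-! ### Membership in a von Neumann algebra -/

variable {M : VonNeumannAlgebra H}

/-- The double commutant theorem in the form used below: closure of `M` under weak limits and
functional calculus reduces to commutation, with no topology on `M`. -/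
lemma mem_of_commute {x : H →L[ℂ] H} (h : ∀ y ∈ M.commutant, Commute y x) : x ∈ M := by
  rw [← M.commutant_commutant, VonNeumannAlgebra.mem_commutant_iff]
  exact fun y hy => h y hy

lemma commute_of_mem {x y : H →L[ℂ] H} (hx : x ∈ M) (hy : y ∈ M.commutant) : Commute y x :=
  ((VonNeumannAlgebra.mem_commutant_iff.1 hy) x hx).symm

lemma WeakLim.mem {ι : Type*} {l : Filter ι} [l.NeBot] {A : ι → (H →L[ℂ] H)} {X : H →L[ℂ] H}
    (hA : WeakLim l A X) (h : ∀ i, A i ∈ M) : X ∈ M :=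
  mem_of_commute fun y hy => (hA.const_mul y).unique ((hA.mul_const y).congr
    (Eventually.of_forall fun i => (commute_of_mem (h i) hy).symm))

lemma cfc_mem {a : H →L[ℂ] H} (ha : a ∈ M) (f : ℝ → ℝ) : cfc f a ∈ M :=
  mem_of_commute fun _ hy => ((commute_of_mem ha hy).symm.cfc_real f).symm

lemma smul_mem_real {a : H →L[ℂ] H} (ha : a ∈ M) (c : ℝ) : c • a ∈ M :=
  mem_of_commute fun _ hy => (commute_of_mem ha hy).smul_right c

lemma abs_mem {a : H →L[ℂ] H} (ha : a ∈ M) : CFC.abs a ∈ M := by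
  rw [CFC.abs, CFC.sqrt_eq_real_sqrt _ (star_mul_self_nonneg a)]
  refine mem_of_commute fun _ hy => ?_
  exact ((commute_of_mem (mul_mem (star_mem ha) ha) hy).symm.cfcₙ_real _).symm

lemma isClosed_vonNeumann : IsClosed (M : Set (H →L[ℂ] H)) := by
  rw [← M.centralizer_centralizer]
  exact Set.isClosed_centralizer _

end

section

variable {H : Type*} [NormedAddCommGroup H] [InnerProductSpace ℂ H] [CompleteSpace H]
variable {M : VonNeumannAlgebra H}

/-! ### Resolvents of positive operators -/

/-- The resolvent `(Z + l)⁻¹`. -/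
def resolv (l : ℝ) (Z : H →L[ℂ] H) : H →L[ℂ] H := cfc (fun x : ℝ => (x + l)⁻¹) Z

/-- The operator `Z (Z + l)⁻¹`. -/
def damp (l : ℝ) (Z : H →L[ℂ] H) : H →L[ℂ] H := 1 - l • resolv l Z

section Resolvent

variable {l : ℝ} {Z : H →L[ℂ] H}

lemma continuousOn_resolv (hl : 0 < l) (hZ : 0 ≤ Z) :
    ContinuousOn (fun x : ℝ => (x + l)⁻¹) (spectrum ℝ Z) :=
  ContinuousOn.inv₀ (by fun_prop) fun x hx => by
    have := spectrum_nonneg_of_nonneg hZ hx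
    positivity

lemma add_smul_one_eq_cfc (hZ : 0 ≤ Z) : Z + l • 1 = cfc (fun x : ℝ => x + l) Z := by
  have hs := IsSelfAdjoint.of_nonneg hZ
  rw [cfc_add_const l (fun x => x) Z, cfc_id' ℝ Z, Algebra.algebraMap_eq_smul_one]

lemma resolv_mul (hl : 0 < l) (hZ : 0 ≤ Z) : resolv l Z * (Z + l • 1) = 1 := by
  have hs := IsSelfAdjoint.of_nonneg hZ
  rw [add_smul_one_eq_cfc hZ, resolv, ← cfc_mul _ _ Z (continuousOn_resolv hl hZ),
    ← cfc_one ℝ Z]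
  refine cfc_congr fun x hx => ?_
  have := spectrum_nonneg_of_nonneg hZ hx
  simp only [Pi.one_apply]
  field_simp

lemma mul_resolv (hl : 0 < l) (hZ : 0 ≤ Z) : (Z + l • 1) * resolv l Z = 1 := by
  rw [add_smul_one_eq_cfc hZ, resolv, cfc_commute_cfc, ← resolv, ← add_smul_one_eq_cfc hZ,
    resolv_mul hl hZ]

lemma resolv_nonneg (hl : 0 < l) (hZ : 0 ≤ Z) : 0 ≤ resolv l Z :=
  cfc_nonneg fun x hx => by
    have := spectrum_nonneg_of_nonneg hZ hx
    positivity

lemma damp_eq_mul_resolv (hl : 0 < l) (hZ : 0 ≤ Z) : damp l Z = Z * resolv l Z := by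
  have := mul_resolv hl hZ
  rw [add_mul, smul_mul_assoc, one_mul] at this
  rw [damp, ← this, add_sub_cancel_right]

lemma damp_eq_resolv_mul (hl : 0 < l) (hZ : 0 ≤ Z) : damp l Z = resolv l Z * Z := by
  have := resolv_mul hl hZ
  rw [mul_add, mul_smul_comm, mul_one] at this
  rw [damp, ← this, add_sub_cancel_right]

lemma resolv_le (hl : 0 < l) (hZ : 0 ≤ Z) : resolv l Z ≤ l⁻¹ • (1 : H →L[ℂ] H) := by
  rw [resolv, ← Algebra.algebraMap_eq_smul_one]
  refine cfc_le_algebraMap _ _ _ (fun x hx => ?_) (continuousOn_resolv hl hZ)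
    (IsSelfAdjoint.of_nonneg hZ)
  have := spectrum_nonneg_of_nonneg hZ hx
  gcongr
  linarith

lemma norm_resolv_le (hl : 0 < l) (hZ : 0 ≤ Z) : ‖resolv l Z‖ ≤ l⁻¹ :=
  norm_le_of_le_smul_one (by positivity) (resolv_nonneg hl hZ) (resolv_le hl hZ)

lemma damp_eq_cfc (hl : 0 < l) (hZ : 0 ≤ Z) : damp l Z = cfc (fun x : ℝ => x / (x + l)) Z := by
  have hs := IsSelfAdjoint.of_nonneg hZ
  rw [damp_eq_mul_resolv hl hZ, resolv]
  conv_lhs => enter [1]; rw [← cfc_id' ℝ Z]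
  rw [← cfc_mul _ _ Z (by fun_prop) (continuousOn_resolv hl hZ)]
  rfl

lemma continuousOn_damp (hl : 0 < l) (hZ : 0 ≤ Z) :
    ContinuousOn (fun x : ℝ => x / (x + l)) (spectrum ℝ Z) :=
  continuousOn_id.mul (continuousOn_resolv hl hZ)

lemma damp_nonneg (hl : 0 < l) (hZ : 0 ≤ Z) : 0 ≤ damp l Z := by
  rw [damp_eq_cfc hl hZ]
  exact cfc_nonneg fun x hx => by
    have := spectrum_nonneg_of_nonneg hZ hx
    positivity

lemma damp_le_one (hl : 0 < l) (hZ : 0 ≤ Z) : damp l Z ≤ 1 :=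
  sub_le_self 1 (smul_nonneg_real hl.le (resolv_nonneg hl hZ))

lemma damp_le_smul (hl : 0 < l) (hZ : 0 ≤ Z) : damp l Z ≤ l⁻¹ • Z := by
  have hs := IsSelfAdjoint.of_nonneg hZ
  rw [damp_eq_cfc hl hZ]
  conv_rhs => rw [← cfc_id' ℝ Z]
  rw [← cfc_smul l⁻¹ (fun x : ℝ => x) Z]
  refine cfc_mono (fun x hx => ?_) (continuousOn_damp hl hZ) (by fun_prop)
  have := spectrum_nonneg_of_nonneg hZ hx
  rw [smul_eq_mul, div_eq_mul_inv, mul_comm]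
  gcongr
  linarith

/-- On `[0, 1]` one has `x / 2 ≤ x / (x + 1)`: damping loses at most a factor two on contractions.
-/
lemma smul_le_damp (hZ : 0 ≤ Z) (hZ1 : Z ≤ 1) : (2⁻¹ : ℝ) • Z ≤ damp 1 Z := by
  have hs := IsSelfAdjoint.of_nonneg hZ
  rw [damp_eq_cfc one_pos hZ]
  conv_lhs => rw [← cfc_id' ℝ Z]
  rw [← cfc_smul (2⁻¹ : ℝ) (fun x : ℝ => x) Z]
  refine cfc_mono (fun x hx => ?_) (by fun_prop) (continuousOn_damp one_pos hZ)
  have h0 := spectrum_nonneg_of_nonneg hZ hx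
  have h1 : x ≤ 1 := by
    have := (le_algebraMap_iff_spectrum_le (R := ℝ) (r := 1) (a := Z)).1 (by simpa using hZ1)
    exact this x hx
  rw [smul_eq_mul, div_eq_mul_inv, mul_comm]
  gcongr
  linarith

lemma damp_anti {l' : ℝ} (hl : 0 < l) (h : l ≤ l') (hZ : 0 ≤ Z) : damp l' Z ≤ damp l Z := by
  have hl' := hl.trans_le h
  rw [damp_eq_cfc hl hZ, damp_eq_cfc hl' hZ]
  refine cfc_mono (fun x hx => ?_) (continuousOn_damp hl' hZ) (continuousOn_damp hl hZ)
  have h0 := spectrum_nonneg_of_nonneg hZ hx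
  gcongr

/-- Inversion is operator antitone. This monotonicity, unavailable for general functions, is why
resolvents serve as truncations. -/
lemma damp_mono {Z' : H →L[ℂ] H} (hl : 0 < l) (hZ : 0 ≤ Z) (h : Z ≤ Z') :
    damp l Z ≤ damp l Z' := by
  have hZ' := hZ.trans h
  let a : (H →L[ℂ] H)ˣ := ⟨Z + l • 1, resolv l Z, mul_resolv hl hZ, resolv_mul hl hZ⟩
  let b : (H →L[ℂ] H)ˣ := ⟨Z' + l • 1, resolv l Z', mul_resolv hl hZ', resolv_mul hl hZ'⟩
  have ha : 0 ≤ (a : H →L[ℂ] H) := add_nonneg hZ (smul_nonneg_real hl.le zero_le_one)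
  have hab : (a : H →L[ℂ] H) ≤ b := add_le_add_left h _
  have := CStarAlgebra.inv_le_inv ha hab
  exact sub_le_sub_left (smul_le_smul_of_nonneg_left this hl.le) 1

lemma resolv_mem (hZ : Z ∈ M) : resolv l Z ∈ M := cfc_mem hZ _

lemma damp_mem (hZ : Z ∈ M) : damp l Z ∈ M := sub_mem (one_mem M) (smul_mem_real (resolv_mem hZ) l)

lemma mul_damp_eq_zero {x : H →L[ℂ] H} (hl : 0 < l) (hZ : 0 ≤ Z) (h : x * Z = 0) :
    x * damp l Z = 0 := by
  rw [damp_eq_mul_resolv hl hZ, ← mul_assoc, h, zero_mul]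

lemma damp_mul_of_mul {x : H →L[ℂ] H} (hl : 0 < l) (hZ : 0 ≤ Z) (h : Z * x = Z) :
    damp l Z * x = damp l Z := by
  rw [damp_eq_resolv_mul hl hZ, mul_assoc, h]

lemma norm_sub_damp_mul_le (hl : 0 < l) (hZ : 0 ≤ Z) : ‖Z - damp l Z * Z‖ ≤ l := by
  have h : Z - damp l Z * Z = l • damp l Z := by
    conv_rhs => rw [damp_eq_resolv_mul hl hZ]
    rw [damp, sub_mul, one_mul, sub_sub_cancel, smul_mul_assoc]
  rw [h, norm_smul, Real.norm_of_nonneg hl.le]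
  exact mul_le_of_le_one_right hl.le (norm_le_one_of_le (damp_nonneg hl hZ) (damp_le_one hl hZ))

/-- Difference of two resolvents. -/
lemma damp_sub_damp {Z' : H →L[ℂ] H} (hl : 0 < l) (hZ : 0 ≤ Z) (hZ' : 0 ≤ Z') :
    damp l Z' - damp l Z = l • (resolv l Z' * (Z' - Z) * resolv l Z) := by
  have h : resolv l Z - resolv l Z' = resolv l Z' * (Z' - Z) * resolv l Z := by
    have : Z' - Z = (Z' + l • 1) - (Z + l • 1) := by abel
    rw [this, mul_sub, sub_mul, resolv_mul hl hZ', one_mul, mul_assoc, mul_resolv hl hZ, mul_one]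
  rw [damp, damp, ← h, smul_sub]
  abel

/-- The resolvents of `y* y` and `y y*` are intertwined by `y`. -/
lemma mul_resolv_star_mul (hl : 0 < l) (y : H →L[ℂ] H) :
    y * resolv l (star y * y) = resolv l (y * star y) * y := by
  have h1 := mul_resolv hl (star_mul_self_nonneg y)
  have h2 := resolv_mul hl (mul_star_self_nonneg y)
  have h3 : y * (star y * y + l • 1) = (y * star y + l • 1) * y := by
    simp [mul_add, add_mul, mul_assoc]
  calc y * resolv l (star y * y)
      = (resolv l (y * star y) * (y * star y + l • 1)) * y * resolv l (star y * y) := by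
        rw [h2, one_mul]
    _ = resolv l (y * star y) * (y * (star y * y + l • 1)) * resolv l (star y * y) := by
        rw [h3]; simp only [mul_assoc]
    _ = resolv l (y * star y) * y := by rw [mul_assoc, mul_assoc, h1, mul_one]

end Resolvent

/-! ### Supports -/

/-- The support projection of a positive operator: a projection `s` which is the least upper
bound of the operators `Z (Z + 1/k)⁻¹`. -/
lemma exists_support {Z : H →L[ℂ] H} (hZM : Z ∈ M) (hZ : 0 ≤ Z) :
    ∃ s ∈ Proj M, s * Z = Z ∧ (∀ x : H →L[ℂ] H, x * Z = 0 → x * s = 0) ∧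
      IsLUB (Set.range fun k : ℕ => damp ((k : ℝ) + 1)⁻¹ Z) s ∧
      Monotone (fun k : ℕ => damp ((k : ℝ) + 1)⁻¹ Z) ∧
      ∃ u : Ultrafilter ℕ, WeakLim (u : Filter ℕ) (fun k : ℕ => damp ((k : ℝ) + 1)⁻¹ Z) s := by
  have hl : ∀ k : ℕ, 0 < ((k : ℝ) + 1)⁻¹ := fun k => by positivity
  have hm : Monotone (fun k : ℕ => damp ((k : ℝ) + 1)⁻¹ Z) := fun i j hij =>
    damp_anti (hl j) (by gcongr) hZ
  obtain ⟨u, s, hu, hs, -, hlub⟩ := exists_weakLim_of_monotone _ hm (fun k => damp_nonneg (hl k) hZ)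
    (fun k => damp_le_one (hl k) hZ)
  -- The error `Z - damp l Z * Z` has norm at most `l`, which tends to zero, so this limit even
  -- holds in norm.
  have hsZ : s * Z = Z := by
    refine (hs.mul_const Z).unique (WeakLim.of_tendsto ?_)
    refine Tendsto.mono_left ?_ hu
    rw [tendsto_iff_norm_sub_tendsto_zero]
    refine squeeze_zero (fun _ => norm_nonneg _) (fun k => ?_)
      (tendsto_one_div_add_atTop_nhds_zero_nat (𝕜 := ℝ))
    rw [norm_sub_rev, one_div]
    exact norm_sub_damp_mul_le (hl k) hZ
  have hs0 : 0 ≤ s := hs.nonneg (Eventually.of_forall fun k => damp_nonneg (hl k) hZ)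
  refine ⟨s, ⟨hs.mem fun k => damp_mem hZM, ⟨?_, IsSelfAdjoint.of_nonneg hs0⟩⟩, hsZ, ?_,
    hlub, hm, u, hs⟩
  -- Idempotence: `s Z = Z` makes `s` fix each `damp l Z = Z * resolv l Z`, hence also their limit
  -- `s`.
  · refine (hs.const_mul s).unique (hs.congr (Eventually.of_forall fun k => ?_))
    simp only [damp_eq_mul_resolv (hl k) hZ, ← mul_assoc, hsZ]
  · intro x hx
    exact (hs.const_mul x).eq_const (Eventually.of_forall fun k => mul_damp_eq_zero (hl k) hZ hx)

/-- A spectral projection of `b ≥ 0` for the half line above `d`. -/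
lemma exists_spectral_proj {b : H →L[ℂ] H} (hbM : b ∈ M) (hb : 0 ≤ b) {d : ℝ} (hd : 0 < d) :
    ∃ q ∈ Proj M, d • q ≤ b ∧ (1 - q) * b * (1 - q) ≤ d • (1 : H →L[ℂ] H) := by
  have hs := IsSelfAdjoint.of_nonneg hb
  -- The projection is the support of `(b - d)₊`. The lower bound compares each approximant of the
  -- support with `d⁻¹ b`; the upper bound comes from `b ≤ (b - d)₊ + d`.
  set Z := cfc (fun x : ℝ => max (x - d) 0) b with hZdef
  have hZ : 0 ≤ Z := cfc_nonneg fun x _ => le_max_right _ _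
  obtain ⟨q, hq, hqZ, -, hlub, -⟩ := exists_support (M := M) (cfc_mem hbM _ : Z ∈ M) hZ
  have hl : ∀ k : ℕ, 0 < ((k : ℝ) + 1)⁻¹ := fun k => by positivity
  have hcZ : ∀ {l : ℝ}, 0 < l → ContinuousOn (fun x : ℝ => x / (x + l))
      ((fun x : ℝ => max (x - d) 0) '' spectrum ℝ b) := by
    rintro l hl
    refine continuousOn_id.div (by fun_prop) ?_
    rintro _ ⟨x, -, rfl⟩
    have := le_max_right (x - d) 0
    positivity
  refine ⟨q, hq, ?_, ?_⟩
  · have h1 : q ≤ d⁻¹ • b := hlub.2 (by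
      rintro _ ⟨k, rfl⟩
      simp only
      rw [damp_eq_cfc (hl k) hZ, hZdef, ← cfc_comp' (fun x : ℝ => x / (x + ((k : ℝ) + 1)⁻¹))
        (fun x : ℝ => max (x - d) 0) b (hcZ (hl k))]
      conv_rhs => rw [← cfc_id' ℝ b]
      rw [← cfc_smul d⁻¹ (fun x : ℝ => x) b]
      refine cfc_mono (fun x hx => ?_) ((hcZ (hl k)).comp (by fun_prop)
        (Set.mapsTo_image _ _)) (by fun_prop)
      have h0 := spectrum_nonneg_of_nonneg hb hx
      rw [smul_eq_mul]
      have hk := hl k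
      rcases le_total x d with h | h
      · rw [max_eq_right (by linarith)]
        simp only [zero_div]
        positivity
      · have h2 : (max (x - d) 0) / (max (x - d) 0 + ((k : ℝ) + 1)⁻¹) ≤ 1 :=
          div_le_one_of_le₀ (by linarith) (by have := le_max_right (x - d) 0; positivity)
        refine h2.trans ?_
        rw [inv_mul_eq_div, one_le_div hd]
        exact h)
    have := smul_le_smul_of_nonneg_left h1 hd.le
    rwa [smul_smul, mul_inv_cancel₀ hd.ne', one_smul] at this
  · have hle : b ≤ Z + d • 1 := by
      have : Z + d • 1 = cfc (fun x : ℝ => max (x - d) 0 + d) b := by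
        rw [cfc_add_const d (fun x => max (x - d) 0) b, Algebra.algebraMap_eq_smul_one]
      rw [this]
      conv_lhs => rw [← cfc_id' ℝ b]
      refine cfc_mono (fun x _ => ?_)
      have := le_max_left (x - d) 0
      linarith
    have hq1 : IsStarProjection (1 - q) := hq.2.one_sub
    have h1 := star_left_conjugate_le_conjugate hle (1 - q)
    rw [proj_star hq1] at h1
    refine h1.trans ?_
    have h2 : (1 - q) * Z = 0 := by rw [sub_mul, one_mul, hqZ, sub_self]
    rw [mul_add, h2, zero_add, mul_smul_comm, mul_one, smul_mul_assoc, proj_mul_self hq1]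
    exact smul_le_smul_of_nonneg_left hq1.le_one hd.le

end

section

variable {H : Type*} [NormedAddCommGroup H] [InnerProductSpace ℂ H] [CompleteSpace H]
variable {M : VonNeumannAlgebra H} {ρ : (H →L[ℂ] H) → ℝ≥0∞}

/-! ### Square roots in `M` and comparison of projections -/

lemma sqrt_mem {a : H →L[ℂ] H} (ha : a ∈ M) (h0 : 0 ≤ a) : CFC.sqrt a ∈ M := by
  rw [CFC.sqrt_eq_real_sqrt _ h0]
  exact mem_of_commute fun _ hy => ((commute_of_mem ha hy).symm.cfcₙ_real _).symm

lemma proj_le_iff {p q : H →L[ℂ] H} (hp : IsStarProjection p) (hq : IsStarProjection q) :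
    p ≤ q ↔ q * p = p :=
  ⟨mul_proj_of_le hq.le_one hp, proj_le_of_mul hq.nonneg hp⟩

lemma mul_eq_of_star_mul_mul {y s : H →L[ℂ] H} (hs : IsStarProjection s)
    (h : s * (star y * y) = star y * y) : y * s = y := by
  have h1 : (1 - s) * (star y * y) * star (1 - s) = 0 := by
    rw [sub_mul, one_mul, h, sub_self, zero_mul]
  have h2 : y * star (1 - s) = 0 := by
    rw [← CStarRing.star_mul_self_eq_zero_iff]
    simpa [mul_assoc] using h1
  rw [star_sub, star_one, proj_star hs, mul_sub, mul_one, sub_eq_zero] at h2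
  exact h2.symm

/-! ### The trace -/

namespace IsFaithfulNormalSemifiniteTrace

variable (hρ : IsFaithfulNormalSemifiniteTrace M ρ)
include hρ

lemma apply_smul {c : ℝ} (hc : 0 ≤ c) {a : H →L[ℂ] H} (ha : a ∈ M) (h0 : 0 ≤ a) :
    ρ (c • a) = ENNReal.ofReal c * ρ a := by
  rw [← hρ.map_smul c hc a ha h0, Complex.coe_smul]

lemma apply_zero : ρ 0 = 0 := by
  simpa using hρ.apply_smul le_rfl (zero_mem M) le_rfl

lemma mono {a b : H →L[ℂ] H} (ha : a ∈ M) (hb : b ∈ M) (h0 : 0 ≤ a) (hab : a ≤ b) :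
    ρ a ≤ ρ b := by
  have := hρ.map_add a ha (b - a) (sub_mem hb ha) h0 (sub_nonneg.2 hab)
  rw [add_sub_cancel] at this
  exact this ▸ le_self_add

lemma eq_iSup {f : ℕ → (H →L[ℂ] H)} (hf : Monotone f) (hM : ∀ k, f k ∈ M) (h0 : ∀ k, 0 ≤ f k)
    {b : H →L[ℂ] H} (hb : b ∈ M) (hlub : IsLUB (Set.range f) b) : ρ b = ⨆ k, ρ (f k) := by
  rw [hρ.normal (Set.range f) (Set.range_subset_iff.2 hM) (Set.forall_mem_range.2 h0)
    (Set.range_nonempty f) (directedOn_range.2 hf.directed_le) b hb hlub, iSup_range]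

/-- With `c` the square root of the resolvent of `y y*`, the two operators are `(c y)* (c y)` and
`(c y) (c y)*`, so the trace property applies. This gives equality of traces of supports without a
polar decomposition. -/
lemma apply_damp_star_mul {y : H →L[ℂ] H} (hy : y ∈ M) {l : ℝ} (hl : 0 < l) :
    ρ (damp l (star y * y)) = ρ (damp l (y * star y)) := by
  set Z := y * star y with hZdef
  have hZM : Z ∈ M := mul_mem hy (star_mem hy)
  have hZ : 0 ≤ Z := mul_star_self_nonneg y
  have hR : 0 ≤ resolv l Z := resolv_nonneg hl hZ
  set c := CFC.sqrt (resolv l Z) with hc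
  have hcM : c ∈ M := sqrt_mem (resolv_mem hZM) hR
  have hcs : star c = c := (IsSelfAdjoint.of_nonneg (CFC.sqrt_nonneg _)).star_eq
  have hcc : c * c = resolv l Z := CFC.sqrt_mul_sqrt_self _ hR
  have hcomm : Commute (resolv l Z) Z := by
    rw [commute_iff_eq, ← damp_eq_mul_resolv hl hZ, ← damp_eq_resolv_mul hl hZ]
  have hcomm' : Commute c Z := by
    rw [hc, CFC.sqrt_eq_real_sqrt _ hR]
    exact hcomm.cfcₙ_real _
  have h1 : damp l (star y * y) = star (c * y) * (c * y) := by
    have h := mul_resolv_star_mul hl (star y)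
    rw [star_star] at h
    rw [damp_eq_resolv_mul hl (star_mul_self_nonneg y), ← mul_assoc, ← h, star_mul, hcs]
    simp only [mul_assoc]
    rw [← mul_assoc c c y, hcc]
  have h2 : damp l Z = (c * y) * star (c * y) := by
    rw [damp_eq_resolv_mul hl hZ, star_mul, hcs, ← hcc, mul_assoc, hcomm'.eq]
    simp only [hZdef, mul_assoc]
  rw [h1, h2]
  exact hρ.trace _ (mul_mem hcM hy)

/-- The left and right supports of an element of `M` have the same trace. -/
lemma exists_supports {y : H →L[ℂ] H} (hy : y ∈ M) :
    ∃ s ∈ Proj M, ∃ t ∈ Proj M, ρ s = ρ t ∧ y * s = y ∧ t * y = y ∧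
      (∀ x : H →L[ℂ] H, x * star y = 0 → x * s = 0) ∧
      (∀ x : H →L[ℂ] H, x * y = 0 → x * t = 0) := by
  have hM1 : star y * y ∈ M := mul_mem (star_mem hy) hy
  have hM2 : y * star y ∈ M := mul_mem hy (star_mem hy)
  have hl : ∀ k : ℕ, 0 < ((k : ℝ) + 1)⁻¹ := fun k => by positivity
  obtain ⟨s, hs, hsy, hs0, hslub, hsm, -⟩ := exists_support hM1 (star_mul_self_nonneg y)
  obtain ⟨t, ht, hty, ht0, htlub, htm, -⟩ := exists_support hM2 (mul_star_self_nonneg y)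
  refine ⟨s, hs, t, ht, ?_, mul_eq_of_star_mul_mul hs.2 hsy, ?_, ?_, ?_⟩
  · rw [hρ.eq_iSup hsm (fun k => damp_mem hM1)
      (fun k => damp_nonneg (hl k) (star_mul_self_nonneg y)) hs.1 hslub,
      hρ.eq_iSup htm (fun k => damp_mem hM2)
      (fun k => damp_nonneg (hl k) (mul_star_self_nonneg y)) ht.1 htlub]
    exact iSup_congr fun k => hρ.apply_damp_star_mul hy (hl k)
  · have := mul_eq_of_star_mul_mul (y := star y) ht.2 (by simpa using hty)
    simpa [proj_star ht.2] using congrArg star this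
  · exact fun x hx => hs0 x (by rw [← mul_assoc, hx, zero_mul])
  · exact fun x hx => ht0 x (by rw [← mul_assoc, hx, zero_mul])

lemma zero_mem_finProj : (0 : H →L[ℂ] H) ∈ FinProj M ρ :=
  ⟨⟨zero_mem M, .zero _⟩, by simp [hρ.apply_zero]⟩

/-- Two projections of finite trace have an upper bound of finite trace. -/
lemma exists_finProj_ge {P Q : H →L[ℂ] H} (hP : P ∈ FinProj M ρ) (hQ : Q ∈ FinProj M ρ) :
    ∃ R ∈ FinProj M ρ, P ≤ R ∧ Q ≤ R := by
  have hPp := hP.1.2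
  have hQp := hQ.1.2
  -- As in the parallelogram law, the right support `s` of `Q (1 - P)` is orthogonal to `P`, and its
  -- left support `t` lies below `Q`. Thus `ρ s = ρ t ≤ ρ Q`, and `P + s` is the required upper
  -- bound.
  have hyM : Q * (1 - P) ∈ M := mul_mem hQ.1.1 (sub_mem (one_mem M) hP.1.1)
  obtain ⟨s, hs, t, ht, hst, hys, -, hs0, ht0⟩ := hρ.exists_supports hyM
  have hPs : P * s = 0 := hs0 P (by
    rw [star_mul, star_sub, star_one, proj_star hPp, ← mul_assoc, mul_sub, mul_one,
      proj_mul_self hPp, sub_self, zero_mul])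
  have hsP : s * P = 0 := by
    simpa [proj_star hPp, proj_star hs.2] using congrArg star hPs
  have htQ : t ≤ Q := by
    rw [proj_le_iff ht.2 hQp]
    have := ht0 (1 - Q) (by rw [← mul_assoc, sub_mul, one_mul, proj_mul_self hQp, sub_self,
      zero_mul])
    rw [sub_mul, one_mul, sub_eq_zero] at this
    exact this.symm
  have hRp : IsStarProjection (P + s) := by
    refine ⟨?_, hPp.isSelfAdjoint.add hs.2.isSelfAdjoint⟩
    change (P + s) * (P + s) = P + s
    simp [mul_add, add_mul, proj_mul_self hPp, proj_mul_self hs.2, hPs, hsP]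
  refine ⟨P + s, ⟨⟨add_mem hP.1.1 hs.1, hRp⟩, ?_⟩, le_add_of_nonneg_right hs.2.nonneg, ?_⟩
  · rw [hρ.map_add P hP.1.1 s hs.1 hPp.nonneg hs.2.nonneg, hst]
    exact ENNReal.add_lt_top.2 ⟨hP.2, (hρ.mono ht.1 hQ.1.1 ht.2.nonneg htQ).trans_lt hQ.2⟩
  · apply proj_le_of_mul hRp.nonneg hQp
    have h1 : Q * (P + s) = Q := by
      have h2 : Q * s - Q * (P * s) = Q - Q * P := by
        simpa [mul_sub, sub_mul, mul_assoc] using hys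
      rw [hPs, mul_zero, sub_zero] at h2
      rw [mul_add, h2, add_sub_cancel]
    simpa [proj_star hQp, proj_star hRp] using congrArg star h1

lemma finProj_of_le {P Q : H →L[ℂ] H} (hP : P ∈ Proj M) (hQ : Q ∈ FinProj M ρ) (h : P ≤ Q) :
    P ∈ FinProj M ρ :=
  ⟨hP, (hρ.mono hP.1 hQ.1.1 hP.2.nonneg h).trans_lt hQ.2⟩

/-- Markov's inequality for the trace. -/
lemma ofReal_mul_le {q b : H →L[ℂ] H} {d : ℝ} (hq : q ∈ Proj M) (hd : 0 < d) (hb : b ∈ M)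
    (h : d • q ≤ b) : ENNReal.ofReal d * ρ q ≤ ρ b := by
  rw [← hρ.apply_smul hd.le hq.1 hq.2.nonneg]
  exact hρ.mono (smul_mem_real hq.1 d) hb (smul_nonneg_real hd.le hq.2.nonneg) h

lemma finProj_of_smul_le {q b : H →L[ℂ] H} {d : ℝ} (hq : q ∈ Proj M) (hd : 0 < d) (hb : b ∈ M)
    (hbρ : ρ b < ∞) (h : d • q ≤ b) : q ∈ FinProj M ρ :=
  ⟨hq, ENNReal.lt_top_of_mul_ne_top_right ((hρ.ofReal_mul_le hq hd hb h).trans_lt hbρ).ne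
    (by simpa using hd)⟩

/-- A projection is determined by its subprojections of finite trace. -/
lemma le_of_forall_finProj_le {P E : H →L[ℂ] H} (hP : P ∈ Proj M) (hE : E ∈ Proj M)
    (h : ∀ P' ∈ FinProj M ρ, P' ≤ P → P' ≤ E) : P ≤ E := by
  have hE1 : IsStarProjection (1 - E) := hE.2.one_sub
  -- This compression vanishes exactly when `P ≤ E`. Otherwise semifiniteness gives `0 ≠ b ≤ a` of
  -- finite trace; its spectral projection `q` above `‖b‖ / 2` is finite and below `P`, hence below
  -- `E`, which forces `q = 0` and then `‖b‖ ≤ ‖b‖ / 2`.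
  set a := star P * (1 - E) * P with ha
  have ha0 : 0 ≤ a := star_left_conjugate_nonneg hE1.nonneg P
  have haM : a ∈ M := mul_mem (mul_mem (star_mem hP.1) (sub_mem (one_mem M) hE.1)) hP.1
  have haP : a ≤ (1 : ℝ) • P := by
    have := star_left_conjugate_le_conjugate hE1.le_one P
    simpa [ha, proj_star hP.2, proj_mul_self hP.2] using this
  by_cases hz : a = 0
  · have h1 : P * (1 - E) = 0 := mul_eq_zero_of_conj hE1.nonneg (by
      rw [proj_star hP.2, ← hz, ha, proj_star hP.2])
    rw [proj_le_iff hP.2 hE.2]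
    rw [mul_sub, mul_one, sub_eq_zero] at h1
    simpa [proj_star hP.2, proj_star hE.2] using (congrArg star h1).symm
  obtain ⟨b, hbM, hb0, hba, hbz, hbρ⟩ := hρ.semifinite a haM ha0 hz
  have hd : 0 < ‖b‖ / 2 := by have := norm_pos_iff.2 hbz; positivity
  obtain ⟨q, hq, hqb, hbq⟩ := exists_spectral_proj hbM hb0 hd
  have hq_of : ∀ x : H →L[ℂ] H, x * a = 0 → x * q = 0 := fun x hx => by
    have := mul_eq_zero_of_le (smul_nonneg_real hd.le hq.2.nonneg) (hqb.trans hba) hx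
    rw [mul_smul_comm, smul_eq_zero] at this
    exact this.resolve_left hd.ne'
  have hqP : q ≤ P := by
    rw [proj_le_iff hq.2 hP.2]
    have := hq_of (1 - P) (by
      rw [ha, proj_star hP.2, ← mul_assoc, ← mul_assoc, sub_mul, one_mul, proj_mul_self hP.2,
        sub_self, zero_mul, zero_mul])
    rw [sub_mul, one_mul, sub_eq_zero] at this
    exact this.symm
  have hqE := h q (hρ.finProj_of_smul_le hq hd hbM hbρ hqb) hqP
  have hqP' : q * P = q := by
    simpa [proj_star hP.2, proj_star hq.2] using congrArg star ((proj_le_iff hq.2 hP.2).1 hqP)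
  have hqE' : q * E = q := by
    simpa [proj_star hE.2, proj_star hq.2] using congrArg star ((proj_le_iff hq.2 hE.2).1 hqE)
  have hq0 : q = 0 := by
    rw [← proj_mul_self hq.2]
    apply hq_of
    rw [ha, proj_star hP.2, ← mul_assoc, ← mul_assoc, hqP', mul_sub, mul_one, hqE', sub_self,
      zero_mul]
  rw [hq0, sub_zero, one_mul, mul_one] at hbq
  have := norm_le_of_le_smul_one hd.le hb0 hbq
  linarith

/-! ### Operators of finite rank -/

lemma finProj_mem_finRank {P : H →L[ℂ] H} (hP : P ∈ FinProj M ρ) : P ∈ FinRank M ρ :=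
  ⟨hP.1.1, P, hP, proj_mul_self hP.1.2⟩

lemma finRank_mul_left {a x : H →L[ℂ] H} (ha : a ∈ M) (hx : x ∈ FinRank M ρ) :
    a * x ∈ FinRank M ρ := by
  obtain ⟨hxM, P, hP, hxP⟩ := hx
  exact ⟨mul_mem ha hxM, P, hP, by rw [mul_assoc, hxP]⟩

/-- The definition only bounds the right support of `x`; the left support has the same trace. -/
lemma finRank_star {x : H →L[ℂ] H} (hx : x ∈ FinRank M ρ) : star x ∈ FinRank M ρ := by
  obtain ⟨hxM, P, hP, hxP⟩ := hx
  obtain ⟨s, hs, t, ht, hst, -, htx, hs0, -⟩ := hρ.exists_supports hxM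
  have hsP : s ≤ P := by
    rw [proj_le_iff hs.2 hP.1.2]
    have := hs0 (1 - P) (by
      have h := congrArg star hxP
      rw [star_mul, proj_star hP.1.2] at h
      rw [sub_mul, one_mul, h, sub_self])
    rw [sub_mul, one_mul, sub_eq_zero] at this
    exact this.symm
  refine ⟨star_mem hxM, t, ⟨ht, hst ▸ (hρ.finProj_of_le hs hP hsP).2⟩, ?_⟩
  simpa [proj_star ht.2] using congrArg star htx

lemma finRank_mul_right {a x : H →L[ℂ] H} (ha : a ∈ M) (hx : x ∈ FinRank M ρ) :
    x * a ∈ FinRank M ρ := by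
  simpa using hρ.finRank_star (hρ.finRank_mul_left (star_mem ha) (hρ.finRank_star hx))

lemma finRank_add {x y : H →L[ℂ] H} (hx : x ∈ FinRank M ρ) (hy : y ∈ FinRank M ρ) :
    x + y ∈ FinRank M ρ := by
  obtain ⟨hxM, P, hP, hxP⟩ := hx
  obtain ⟨hyM, Q, hQ, hyQ⟩ := hy
  obtain ⟨R, hR, hPR, hQR⟩ := hρ.exists_finProj_ge hP hQ
  have hPR' : P * R = P := by
    simpa [proj_star hP.1.2, proj_star hR.1.2] using
      congrArg star ((proj_le_iff hP.1.2 hR.1.2).1 hPR)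
  have hQR' : Q * R = Q := by
    simpa [proj_star hQ.1.2, proj_star hR.1.2] using
      congrArg star ((proj_le_iff hQ.1.2 hR.1.2).1 hQR)
  refine ⟨add_mem hxM hyM, R, hR, ?_⟩
  rw [add_mul, ← hxP, ← hyQ, mul_assoc, mul_assoc, hPR', hQR']

lemma finRank_smul (c : ℂ) {x : H →L[ℂ] H} (hx : x ∈ FinRank M ρ) : c • x ∈ FinRank M ρ := by
  have h := hρ.finRank_mul_left
    (M.toStarSubalgebra.smul_mem (one_mem M.toStarSubalgebra) c : c • (1 : H →L[ℂ] H) ∈ M) hx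
  rwa [smul_mul_assoc, one_mul] at h

lemma finRank_sub {x y : H →L[ℂ] H} (hx : x ∈ FinRank M ρ) (hy : y ∈ FinRank M ρ) :
    x - y ∈ FinRank M ρ := by
  simpa [sub_eq_add_neg] using hρ.finRank_add hx (hρ.finRank_smul (-1) hy)

/-- If `x P = x` then `|x| P = |x|`, so `|x|` is dominated by a multiple of `P`. -/
lemma finRank_subset {x : H →L[ℂ] H} (hx : x ∈ FinRank M ρ) : x ∈ L1Inter M ρ := by
  obtain ⟨hxM, P, hP, hxP⟩ := hx
  refine ⟨hxM, ?_⟩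
  have hp := hP.1.2
  have habs : 0 ≤ CFC.abs x := CFC.abs_nonneg x
  have h1 : CFC.abs x * P = CFC.abs x := by
    have h2 : CFC.abs x * (1 - P) = 0 := by
      rw [← CStarRing.star_mul_self_eq_zero_iff, star_mul, (IsSelfAdjoint.of_nonneg habs).star_eq,
        mul_assoc, ← mul_assoc (CFC.abs x), CFC.abs_mul_abs, mul_assoc, mul_sub, mul_one, hxP,
        sub_self, mul_zero, mul_zero]
    rw [mul_sub, mul_one, sub_eq_zero] at h2
    exact h2.symm
  refine (hρ.mono (abs_mem hxM) (smul_mem_real hP.1.1 _) habs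
    (le_norm_smul_proj habs hp h1)).trans_lt ?_
  rw [hρ.apply_smul (norm_nonneg _) hP.1.1 hp.nonneg]
  exact ENNReal.mul_lt_top ENNReal.ofReal_lt_top hP.2

end IsFaithfulNormalSemifiniteTrace

end

section

variable {H : Type*} [NormedAddCommGroup H] [InnerProductSpace ℂ H] [CompleteSpace H]
variable {M : VonNeumannAlgebra H} {ρ : (H →L[ℂ] H) → ℝ≥0∞} {N : (H →L[ℂ] H) → ℝ}

/-! ### Symmetric operator norms on operators of finite rank -/

lemma bddBelow_singularValue_set (t : ℝ) (x : H →L[ℂ] H) :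
    BddBelow {r | ∃ P ∈ FinProj M ρ, ρ P ≤ ENNReal.ofReal t ∧ r = ‖x * (1 - P)‖} :=
  ⟨0, by rintro _ ⟨P, -, -, rfl⟩; exact norm_nonneg _⟩

/-- All norm inequalities below use this: exhibit, for each competitor for `y`, a competitor for `x`
that is no worse. The projection `0` keeps the infimum from being over an empty set. -/
lemma IsFaithfulNormalSemifiniteTrace.singularValue_le (hρ : IsFaithfulNormalSemifiniteTrace M ρ)
    {t : ℝ} {x y : H →L[ℂ] H}
    (h : ∀ P ∈ FinProj M ρ, ∃ P' ∈ FinProj M ρ, ρ P' ≤ ρ P ∧ ‖x * (1 - P')‖ ≤ ‖y * (1 - P)‖) :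
    singularValue M ρ t x ≤ singularValue M ρ t y := by
  refine le_csInf ⟨_, 0, hρ.zero_mem_finProj, by simp [hρ.apply_zero], rfl⟩ ?_
  rintro _ ⟨P, hP, hPt, rfl⟩
  obtain ⟨P', hP', hle, hn⟩ := h P hP
  exact (csInf_le (bddBelow_singularValue_set t x) ⟨P', hP', hle.trans hPt, rfl⟩).trans hn

namespace IsSymmetricOperatorNorm

variable (hN : IsSymmetricOperatorNorm M ρ N) (hρ : IsFaithfulNormalSemifiniteTrace M ρ)
include hN hρ

lemma apply_zero : N 0 = 0 := by
  simpa using hN.smul_eq 0 0 (hρ.finRank_subset (hρ.finProj_mem_finRank hρ.zero_mem_finProj))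

lemma apply_smul {c : ℝ} (hc : 0 ≤ c) {x : H →L[ℂ] H} (hx : x ∈ FinRank M ρ) :
    N (c • x) = c * N x := by
  rw [← Complex.coe_smul, hN.smul_eq _ _ (hρ.finRank_subset hx), Complex.norm_real,
    Real.norm_of_nonneg hc]

lemma apply_neg {x : H →L[ℂ] H} (hx : x ∈ FinRank M ρ) : N (-x) = N x := by
  simpa using hN.smul_eq (-1) x (hρ.finRank_subset hx)

lemma apply_add_le {x y : H →L[ℂ] H} (hx : x ∈ FinRank M ρ) (hy : y ∈ FinRank M ρ) :
    N (x + y) ≤ N x + N y :=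
  hN.add_le x (hρ.finRank_subset hx) y (hρ.finRank_subset hy)

lemma apply_sub_le {x y : H →L[ℂ] H} (hx : x ∈ FinRank M ρ) (hy : y ∈ FinRank M ρ) :
    N (x - y) ≤ N x + N y := by
  have h := hN.apply_add_le hρ hx (hρ.finRank_smul (-1) hy)
  rwa [neg_one_smul, hN.apply_neg hρ hy, ← sub_eq_add_neg] at h

lemma nonneg {x : H →L[ℂ] H} (hx : x ∈ FinRank M ρ) : 0 ≤ N x := by
  have h := hN.apply_sub_le hρ hx hx
  rw [sub_self, hN.apply_zero hρ] at h
  linarith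

/-- For a competitor `P`, the left support `q` of `x P` has trace at most `ρ P`, and `(1 - q) x = (1
- q) x (1 - P)`; hence `q` is a competitor for `x*`. -/
lemma apply_star_le {x : H →L[ℂ] H} (hx : x ∈ FinRank M ρ) : N (star x) ≤ N x := by
  refine hN.mono _ (hρ.finRank_subset (hρ.finRank_star hx)) _ (hρ.finRank_subset hx)
    fun t _ => hρ.singularValue_le fun P hP => ?_
  obtain ⟨s, hs, q, hq, hsq, -, hqx, hs0, -⟩ := hρ.exists_supports (mul_mem hx.1 hP.1.1)
  have hPp := hP.1.2
  have hsP : s ≤ P := by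
    rw [proj_le_iff hs.2 hPp]
    have := hs0 (1 - P) (by
      rw [star_mul, proj_star hPp, ← mul_assoc, sub_mul, one_mul, proj_mul_self hPp, sub_self,
        zero_mul])
    rw [sub_mul, one_mul, sub_eq_zero] at this
    exact this.symm
  have hsρ := hρ.mono hs.1 hP.1.1 hs.2.nonneg hsP
  refine ⟨q, ⟨hq, hsq ▸ hsρ.trans_lt hP.2⟩, hsq ▸ hsρ, ?_⟩
  have h1 : (1 - q) * x = (1 - q) * (x * (1 - P)) := by
    rw [mul_sub x, mul_one, mul_sub, sub_mul 1 q (x * P), one_mul, hqx, sub_self, sub_zero]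
  calc ‖star x * (1 - q)‖ = ‖star ((1 - q) * x)‖ := by
        rw [star_mul, proj_star hq.2.one_sub]
    _ = ‖(1 - q) * (x * (1 - P))‖ := by rw [norm_star, h1]
    _ ≤ ‖1 - q‖ * ‖x * (1 - P)‖ := norm_mul_le _ _
    _ ≤ ‖x * (1 - P)‖ := mul_le_of_le_one_left (norm_nonneg _) (norm_proj_le hq.2.one_sub)

lemma apply_mul_left_le {a x : H →L[ℂ] H} (ha : a ∈ M) (hx : x ∈ FinRank M ρ) :
    N (a * x) ≤ ‖a‖ * N x := by
  rcases eq_or_ne a 0 with rfl | h0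
  · simp [hN.apply_zero hρ]
  have hn : 0 < ‖a‖ := norm_pos_iff.2 h0
  have hM' := smul_mem_real ha ‖a‖⁻¹
  have h1 : a * x = ‖a‖ • ((‖a‖⁻¹ • a) * x) := by
    rw [smul_mul_assoc, smul_smul, mul_inv_cancel₀ hn.ne', one_smul]
  have hax := hρ.finRank_mul_left hM' hx
  rw [h1, hN.apply_smul hρ hn.le hax]
  refine mul_le_mul_of_nonneg_left ?_ hn.le
  refine hN.mono _ (hρ.finRank_subset hax) _ (hρ.finRank_subset hx)
    fun t _ => hρ.singularValue_le fun P hP => ⟨P, hP, le_rfl, ?_⟩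
  rw [mul_assoc]
  refine (norm_mul_le _ _).trans (mul_le_of_le_one_left (norm_nonneg _) ?_)
  rw [norm_smul, norm_inv, norm_norm, inv_mul_cancel₀ hn.ne']

lemma apply_mul_right_le {a x : H →L[ℂ] H} (ha : a ∈ M) (hx : x ∈ FinRank M ρ) :
    N (x * a) ≤ ‖a‖ * N x := by
  have h1 := hρ.finRank_mul_left (star_mem ha) (hρ.finRank_star hx)
  have h2 := hN.apply_star_le hρ h1
  rw [star_mul, star_star, star_star] at h2
  refine h2.trans ((hN.apply_mul_left_le hρ (star_mem ha) (hρ.finRank_star hx)).trans ?_)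
  rw [norm_star]
  exact mul_le_mul_of_nonneg_left (hN.apply_star_le hρ hx) (norm_nonneg _)

lemma exists_small_proj {ε : ℝ} (hε : 0 < ε) :
    ∃ δ : ℝ≥0∞, 0 < δ ∧ ∀ q ∈ FinProj M ρ, ρ q < δ → N q < ε := by
  by_contra! h
  choose q hq hqρ hqN using fun k : ℕ => h (((k : ℝ≥0∞))⁻¹) (by simp)
  have h1 := hN.tendsto_proj q hq (tendsto_of_tendsto_of_tendsto_of_le_of_le tendsto_const_nhds
    ENNReal.tendsto_inv_nat_nhds_zero (fun _ => zero_le) fun k => (hqρ k).le)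
  exact absurd (ge_of_tendsto h1 (Eventually.of_forall hqN)) (not_le.2 hε)

end IsSymmetricOperatorNorm

/-! ### Continuity of the trace below a finite projection -/

lemma apply_eq_zero_of_re_inner {V : H →L[ℂ] H} (hV : 0 ≤ V) {ζ : H}
    (h : (inner ℂ (V ζ) ζ).re ≤ 0) : V ζ = 0 := by
  obtain ⟨s, rfl⟩ := CStarAlgebra.nonneg_iff_eq_star_mul_self.1 hV
  rw [re_inner_star_mul_self] at h
  have : s ζ = 0 := norm_eq_zero.1 (pow_eq_zero_iff two_ne_zero |>.1 (le_antisymm h (sq_nonneg _)))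
  rw [mul_apply_eq_comp, this, map_zero]

lemma le_proj_of_mul {a P : H →L[ℂ] H} (ha : 0 ≤ a) (ha1 : a ≤ 1) (hP : IsStarProjection P)
    (h : a * P = a) : a ≤ P := by
  have h1 := star_left_conjugate_le_conjugate ha1 P
  rwa [proj_star hP, proj_mul_comm_left (IsSelfAdjoint.of_nonneg ha) hP h, h, mul_one,
    proj_mul_self hP] at h1

/-- The trace is continuous for the weak operator topology on the positive operators below a
projection of finite trace. -/
lemma IsFaithfulNormalSemifiniteTrace.exists_index_apply_lt
    (hρ : IsFaithfulNormalSemifiniteTrace M ρ) {P : H →L[ℂ] H} (hP : P ∈ FinProj M ρ)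
    {ξ : ℕ → H} (hξ : DenseRange ξ) {ε : ℝ≥0∞} (hε : 0 < ε) :
    ∃ k : ℕ, ∀ x ∈ M, 0 ≤ x → x ≤ P →
      (∀ i ≤ k, (inner ℂ (x (ξ i)) (ξ i)).re ≤ (1 / 2 : ℝ) ^ k) → ρ x < ε := by
  by_contra! h
  choose x hxM hx0 hxP hxξ hxε using h
  have hPp := hP.1.2
  have hxP' : ∀ k, x k * P = x k := fun k =>
    mul_proj_of_le_smul (c := 1) (hx0 k) hPp (by simpa using hxP k)
  -- A Borel–Cantelli argument. The sums starting at `k` may be unbounded, so they are damped before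
  -- taking the supremum `Y k` over `l`. The `Y k` decrease, lie below `P`, and dominate `x k / 2`.
  let S : ℕ → ℕ → (H →L[ℂ] H) := fun k l => ∑ m ∈ Finset.range l, x (k + m)
  have hS0 : ∀ k l, 0 ≤ S k l := fun k l => Finset.sum_nonneg fun m _ => hx0 _
  have hSM : ∀ k l, S k l ∈ M := fun k l => sum_mem fun m _ => hxM _
  have hSP : ∀ k l, S k l * P = S k l := fun k l => by
    simp only [S, Finset.sum_mul, hxP']
  have hmono : ∀ k, Monotone fun l => damp 1 (S k l) := fun k =>
    monotone_nat_of_le_succ fun l => damp_mono one_pos (hS0 k l) (by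
      simp only [S, Finset.sum_range_succ]
      exact le_add_of_nonneg_right (hx0 _))
  choose u Y hu hY hle hlub using fun k => exists_weakLim_of_monotone _ (hmono k)
    (fun l => damp_nonneg one_pos (hS0 k l)) (fun l => damp_le_one one_pos (hS0 k l))
  have hY0 : ∀ k, 0 ≤ Y k := fun k => (damp_nonneg one_pos (hS0 k 0)).trans (hle k 0)
  have hYM : ∀ k, Y k ∈ M := fun k => (hY k).mem fun l => damp_mem (hSM k l)
  have hYP : ∀ k, Y k ≤ P := fun k => by
    refine le_proj_of_mul (hY0 k) ?_ hPp ?_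
    · exact (hY k).le_const (Eventually.of_forall fun l => damp_le_one one_pos (hS0 k l))
    · exact ((hY k).mul_const P).unique ((hY k).congr (Eventually.of_forall fun l =>
        (damp_mul_of_mul one_pos (hS0 k l) (hSP k l)).symm))
  have hYanti : ∀ k, Y (k + 1) ≤ Y k := fun k => (hlub (k + 1)).2 (by
    rintro _ ⟨l, rfl⟩
    refine (damp_mono one_pos (hS0 _ _) ?_).trans (hle k (l + 1))
    have : S k (l + 1) = S (k + 1) l + x k := by
      simp only [S, Finset.sum_range_succ', add_zero]
      congr 1
      exact Finset.sum_congr rfl fun m _ => by rw [add_assoc, add_comm 1 m]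
    rw [this]
    exact le_add_of_nonneg_right (hx0 k))
  have hYξ : ∀ i k, i ≤ k → (inner ℂ (Y k (ξ i)) (ξ i)).re ≤ 2 * (1 / 2 : ℝ) ^ k := by
    intro i k hik
    refine le_of_tendsto ((hY k).re_inner (ξ i)) (Eventually.of_forall fun l => ?_)
    have h1 : damp 1 (S k l) ≤ S k l := by
      simpa using damp_le_smul one_pos (hS0 k l)
    refine (re_inner_mono h1 _).trans ?_
    have h2 : (inner ℂ (S k l (ξ i)) (ξ i)).re
        = ∑ m ∈ Finset.range l, (inner ℂ (x (k + m) (ξ i)) (ξ i)).re := by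
      simp only [S, sum_apply, sum_inner, Complex.re_sum]
    rw [h2]
    calc _ ≤ ∑ m ∈ Finset.range l, (1 / 2 : ℝ) ^ (k + m) :=
          Finset.sum_le_sum fun m _ => hxξ (k + m) i (by omega)
      _ = (1 / 2 : ℝ) ^ k * ∑ m ∈ Finset.range l, (1 / 2 : ℝ) ^ m := by
          rw [Finset.mul_sum]; exact Finset.sum_congr rfl fun m _ => pow_add _ _ _
      _ ≤ (1 / 2 : ℝ) ^ k * 2 := by
          gcongr
          exact sum_geometric_two_le l
      _ = _ := mul_comm _ _
  have hWmono : Monotone fun k => P - Y k :=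
    monotone_nat_of_le_succ fun k => sub_le_sub_left (hYanti k) P
  obtain ⟨v, W, hv, hW, hWle, hWlub⟩ := exists_weakLim_of_monotone _ hWmono
    (fun k => sub_nonneg.2 (hYP k)) (fun k => (sub_le_self P (hY0 k)).trans hPp.le_one)
  have hVlim : WeakLim (v : Filter ℕ) Y (P - W) :=
    ((WeakLim.const P).sub hW).congr (Eventually.of_forall fun k => sub_sub_cancel P (Y k))
  have hV0 : 0 ≤ P - W := hVlim.nonneg (Eventually.of_forall hY0)
  -- The limit `P - W` of the `Y k` is killed on the dense sequence by the geometric bounds, so it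
  -- vanishes and `P - Y k` increases to `P`.
  have hVξ : ∀ i, (P - W) (ξ i) = 0 := fun i => by
    apply apply_eq_zero_of_re_inner hV0
    have h1 : Tendsto (fun k : ℕ => 2 * (1 / 2 : ℝ) ^ k) v (𝓝 (2 * 0)) :=
      ((tendsto_pow_atTop_nhds_zero_of_lt_one (by norm_num) (by norm_num)).const_mul 2).mono_left hv
    rw [mul_zero] at h1
    exact le_of_tendsto_of_tendsto (hVlim.re_inner (ξ i)) h1
      (hv ((eventually_ge_atTop i).mono fun k hk => hYξ i k hk))
  have hWP : W = P := by
    have : (⇑(P - W) : H → H) = fun _ => 0 :=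
      hξ.equalizer (P - W).continuous continuous_const (funext hVξ)
    exact (sub_eq_zero.1 (ContinuousLinearMap.ext fun ζ => congrFun this ζ)).symm
  rw [hWP] at hWlub
  have hsup := hρ.eq_iSup hWmono (fun k => sub_mem hP.1.1 (hYM k))
    (fun k => sub_nonneg.2 (hYP k)) hP.1.1 hWlub
  set c := ENNReal.ofReal 2⁻¹ * ε with hc
  have hc0 : c ≠ 0 := mul_ne_zero (by simp) hε.ne'
  have hcY : ∀ k, c ≤ ρ (Y k) := fun k => by
    have h1 : (2⁻¹ : ℝ) • x k ≤ Y k := by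
      refine (smul_le_damp (hx0 k) ((hxP k).trans hPp.le_one)).trans ?_
      simpa [S] using hle k 1
    calc c ≤ ENNReal.ofReal 2⁻¹ * ρ (x k) := mul_le_mul' le_rfl (hxε k)
      _ = ρ ((2⁻¹ : ℝ) • x k) := (hρ.apply_smul (by norm_num) (hxM k) (hx0 k)).symm
      _ ≤ _ := hρ.mono (smul_mem_real (hxM k) _) (hYM k)
          (smul_nonneg_real (by norm_num) (hx0 k)) h1
  have hcP : c ≤ ρ P := (hcY 0).trans (hρ.mono (hYM 0) hP.1.1 (hY0 0) (hYP 0))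
  -- Normality gives `ρ P = ⨆ ρ (P - Y k)`, while every `Y k` carries trace at least `c`; as `ρ P`
  -- is finite and `c > 0`, this is absurd.
  have hle' : ρ P ≤ ρ P - c := by
    conv_lhs => rw [hsup]
    refine iSup_le fun k => ENNReal.le_sub_of_add_le_right (hcP.trans_lt hP.2).ne ?_
    calc ρ (P - Y k) + c ≤ ρ (P - Y k) + ρ (Y k) := by gcongr; exact hcY k
      _ = ρ P := by
        rw [← hρ.map_add _ (sub_mem hP.1.1 (hYM k)) _ (hYM k) (sub_nonneg.2 (hYP k)) (hY0 k),
          sub_add_cancel]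
  exact absurd hle' (not_le.2 (ENNReal.sub_lt_self hP.2.ne
    (hc0.bot_lt.trans_le hcP).ne' hc0))

/-- On contractions cut down by a projection of finite trace, strong convergence implies
convergence for a symmetric operator norm. -/
lemma IsSymmetricOperatorNorm.exists_finset_apply_mul_le [TopologicalSpace.SeparableSpace H]
    (hN : IsSymmetricOperatorNorm M ρ N) (hρ : IsFaithfulNormalSemifiniteTrace M ρ)
    {P : H →L[ℂ] H} (hP : P ∈ FinProj M ρ) {ε : ℝ} (hε : 0 < ε) :
    ∃ (F : Finset H) (δ : ℝ), 0 < δ ∧ ∀ y ∈ M, ‖y‖ ≤ 1 → (∀ ζ ∈ F, ‖y (P ζ)‖ ≤ δ) →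
      N (y * P) ≤ ε := by
  classical
  have hPp := hP.1.2
  have hNP := hN.nonneg hρ (hρ.finProj_mem_finRank hP)
  set r := ε / (2 * (N P + 1)) with hr
  have hr0 : 0 < r := by positivity
  have hrN : r * N P ≤ ε / 2 := by
    rw [hr, div_mul_eq_mul_div, div_le_div_iff₀ (by positivity) (by positivity)]
    nlinarith
  obtain ⟨η, hη, hηN⟩ := hN.exists_small_proj hρ (half_pos hε)
  have hd : 0 < r ^ 2 := by positivity
  obtain ⟨k, hk⟩ := hρ.exists_index_apply_lt hP (TopologicalSpace.denseRange_denseSeq H)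
    (ε := ENNReal.ofReal (r ^ 2) * η) (ENNReal.mul_pos (by simpa using hr0.ne') hη.ne')
  refine ⟨(Finset.range (k + 1)).image (TopologicalSpace.denseSeq H), (1 / 2 : ℝ) ^ k,
    by positivity, fun y hyM hy1 hyF => ?_⟩
  have hyPM : y * P ∈ M := mul_mem hyM hP.1.1
  -- The operator `y P` is cut at height `r`: on the spectral projection `q` of `b` above `r ^ 2`
  -- the trace is less than `η`, and off `q` the operator norm is at most `r`. Each piece
  -- contributes at most `ε / 2`.
  set b := star (y * P) * (y * P) with hb
  have hb0 : 0 ≤ b := star_mul_self_nonneg _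
  have hbM : b ∈ M := mul_mem (star_mem hyPM) hyPM
  have hbP : b ≤ P := by
    have h1 : star y * y ≤ 1 := by
      apply le_one_of_norm_le (star_mul_self_nonneg y)
      rw [CStarRing.norm_star_mul_self]
      exact mul_le_one₀ hy1 (norm_nonneg _) hy1
    have h2 := star_left_conjugate_le_conjugate h1 P
    rw [mul_one, proj_star hPp, proj_mul_self hPp] at h2
    simpa [hb, mul_assoc, proj_star hPp] using h2
  have hbρ : ρ b < ENNReal.ofReal (r ^ 2) * η := by
    refine hk b hbM hb0 hbP fun i hi => ?_
    rw [hb, re_inner_star_mul_self, mul_apply_eq_comp]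
    have h1 := hyF _ (Finset.mem_image_of_mem _ (Finset.mem_range.2 (Nat.lt_succ_of_le hi)))
    -- Since `δ = (1 / 2) ^ k` is at most one, `‖y P ξ‖ ≤ δ` also yields the bound `δ` for its
    -- square.
    have h2 : (1 / 2 : ℝ) ^ k ≤ 1 := pow_le_one₀ (by norm_num) (by norm_num)
    have h3 : (0 : ℝ) ≤ (1 / 2 : ℝ) ^ k := by positivity
    nlinarith [norm_nonneg (y (P (TopologicalSpace.denseSeq H i)))]
  obtain ⟨q, hq, hqb, hbq⟩ := exists_spectral_proj hbM hb0 hd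
  have hqfin := hρ.finProj_of_smul_le hq hd hbM
    ((hρ.mono hbM hP.1.1 hb0 hbP).trans_lt hP.2) hqb
  have hqρ : ρ q < η :=
    lt_of_mul_lt_mul_left' ((hρ.ofReal_mul_le hq hd hbM hqb).trans_lt hbρ)
  have hPq : P * q = q := by
    have h0 : (1 - P) * ((r ^ 2) • q) = 0 :=
      mul_eq_zero_of_le (smul_nonneg_real hd.le hq.2.nonneg) (hqb.trans hbP)
        (by rw [sub_mul, one_mul, proj_mul_self hPp, sub_self])
    rw [mul_smul_comm, smul_eq_zero, sub_mul, one_mul, sub_eq_zero] at h0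
    exact (h0.resolve_left hd.ne').symm
  have hqP : q * P = q := by
    simpa [proj_star hPp, proj_star hq.2] using congrArg star hPq
  have hq1 : IsStarProjection (1 - q) := hq.2.one_sub
  have hnorm : ‖y * P * (1 - q)‖ ≤ r := by
    rw [← abs_of_nonneg (norm_nonneg (y * P * (1 - q))), ← abs_of_pos hr0]
    apply sq_le_sq.1
    rw [sq, ← CStarRing.norm_star_mul_self, star_mul, proj_star hq1]
    refine norm_le_of_le_smul_one hd.le ?_ ?_
    · have := star_left_conjugate_nonneg hb0 (1 - q)
      simpa [hb, proj_star hq1, mul_assoc] using this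
    · simpa [hb, mul_assoc] using hbq
  have hsplit : y * P = y * P * (1 - q) * P + y * q := by
    have : P * (1 - q) * P = P - q := by
      rw [mul_sub, mul_one, hPq, sub_mul, proj_mul_self hPp, hqP]
    rw [mul_assoc y, mul_assoc y, this, mul_sub, sub_add_cancel]
  have hPF := hρ.finProj_mem_finRank hP
  have hqF := hρ.finProj_mem_finRank hqfin
  have hM1 : y * P * (1 - q) ∈ M := mul_mem hyPM (sub_mem (one_mem M) hq.1)
  calc N (y * P) ≤ N (y * P * (1 - q) * P) + N (y * q) := by
        conv_lhs => rw [hsplit]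
        exact hN.apply_add_le hρ (hρ.finRank_mul_left hM1 hPF) (hρ.finRank_mul_left hyM hqF)
    _ ≤ ‖y * P * (1 - q)‖ * N P + ‖y‖ * N q :=
        add_le_add (hN.apply_mul_left_le hρ hM1 hPF) (hN.apply_mul_left_le hρ hyM hqF)
    _ ≤ r * N P + 1 * N q :=
        add_le_add (mul_le_mul_of_nonneg_right hnorm hNP)
          (mul_le_mul_of_nonneg_right hy1 (hN.nonneg hρ hqF))
    _ ≤ ε := by linarith [hηN q hqfin hqρ]

end

section

variable {H : Type*} [NormedAddCommGroup H] [InnerProductSpace ℂ H] [CompleteSpace H]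
variable {M : VonNeumannAlgebra H} {ρ : (H →L[ℂ] H) → ℝ≥0∞} {N : (H →L[ℂ] H) → ℝ}

/-! ### Twisted derivations -/

/-- The common features of the maps `A ↦ [T, A]` and `A ↦ α(A) - A`: they are linear, satisfy a
Leibniz rule twisted by a contractive unital homomorphism `β`, and are bounded for `N` on the
operators of finite rank. -/
structure IsTwistedDerivation (M : VonNeumannAlgebra H) (ρ : (H →L[ℂ] H) → ℝ≥0∞)
    (N : (H →L[ℂ] H) → ℝ) (d : M.toStarSubalgebra → (H →L[ℂ] H)) : Prop where
  finRank : ∀ x : M.toStarSubalgebra, (x : H →L[ℂ] H) ∈ FinRank M ρ → d x ∈ FinRank M ρ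
  map_add : ∀ x y, d (x + y) = d x + d y
  map_smul : ∀ (c : ℂ) (x), d (c • x) = c • d x
  map_one : d 1 = 0
  bound : ∃ c : ℝ, 0 ≤ c ∧ ∀ x : M.toStarSubalgebra, (x : H →L[ℂ] H) ∈ FinRank M ρ →
    N (d x) ≤ c * N x
  leibniz : ∃ β : M.toStarSubalgebra → (H →L[ℂ] H), (∀ x, β x ∈ M) ∧
    (∀ x, ‖β x‖ ≤ ‖(x : H →L[ℂ] H)‖) ∧ (∀ x y, β (x * y) = β x * β y) ∧ β 1 = 1 ∧
    ∀ x y, d (x * y) = d x * β y + x * d y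

namespace IsTwistedDerivation

variable {d : M.toStarSubalgebra → (H →L[ℂ] H)} (hd : IsTwistedDerivation M ρ N d)
  (hN : IsSymmetricOperatorNorm M ρ N) (hρ : IsFaithfulNormalSemifiniteTrace M ρ)
include hd hN hρ

/-- Both Leibniz terms are bounded using `‖β x‖ ≤ ‖x‖`. This allows selfadjoint sequences to be
replaced by their positive squares. -/
lemma apply_mul_self_le {x : M.toStarSubalgebra} (hx : (x : H →L[ℂ] H) ∈ FinRank M ρ) :
    N (d (x * x)) ≤ 2 * ‖(x : H →L[ℂ] H)‖ * N (d x) := by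
  obtain ⟨β, hβM, hβ, -, -, hL⟩ := hd.leibniz
  have hdx := hd.finRank x hx
  rw [hL]
  have h1 := hN.apply_add_le hρ (hρ.finRank_mul_right (hβM x) hdx)
    (hρ.finRank_mul_left x.2 hdx)
  have h2 := hN.apply_mul_right_le hρ (hβM x) hdx
  have h3 := hN.apply_mul_left_le hρ x.2 hdx
  have h4 := mul_le_mul_of_nonneg_right (hβ x) (hN.nonneg hρ hdx)
  linarith

/-- Applying the Leibniz rule to `r (x + l) = 1` gives `d r = -r (d x) β(r)`. This has finite rank
although `r` need not, and two resolvent bounds `l⁻¹` against the factor `l` leave `l⁻¹`. -/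
lemma apply_damp_le {x y : M.toStarSubalgebra} (hx : (x : H →L[ℂ] H) ∈ FinRank M ρ)
    (hx0 : 0 ≤ (x : H →L[ℂ] H)) {l : ℝ} (hl : 0 < l)
    (hy : (y : H →L[ℂ] H) = damp l (x : H →L[ℂ] H)) :
    N (d y) ≤ l⁻¹ * N (d x) := by
  obtain ⟨β, hβM, hβ, hβmul, hβ1, hL⟩ := hd.leibniz
  have hdx := hd.finRank x hx
  let r : M.toStarSubalgebra := ⟨resolv l (x : H →L[ℂ] H), resolv_mem x.2⟩
  have hr : ‖(r : H →L[ℂ] H)‖ ≤ l⁻¹ := norm_resolv_le hl hx0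
  let z : M.toStarSubalgebra := x + (l : ℂ) • 1
  have hzc : (z : H →L[ℂ] H) = (x : H →L[ℂ] H) + l • 1 := by
    simp [z]
  have hrz : r * z = 1 := Subtype.ext (by
    change resolv l (x : H →L[ℂ] H) * (z : H →L[ℂ] H) = 1
    rw [hzc, resolv_mul hl hx0])
  have hzr : z * r = 1 := Subtype.ext (by
    change (z : H →L[ℂ] H) * resolv l (x : H →L[ℂ] H) = 1
    rw [hzc, mul_resolv hl hx0])
  have hdz : d z = d x := by
    rw [hd.map_add, hd.map_smul, hd.map_one, smul_zero, add_zero]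
  have h1 : d r * β z = -(r * d x) := by
    have := hL r z
    rw [hrz, hd.map_one, hdz] at this
    exact eq_neg_of_add_eq_zero_left this.symm
  have h2 : d r = -(r * d x * β r) := by
    calc d r = d r * β (z * r) := by rw [hzr, hβ1, mul_one]
      _ = _ := by rw [hβmul, ← mul_assoc, h1, neg_mul]
  have hy' : y = 1 + (-(l : ℂ)) • r := Subtype.ext (by
    rw [hy, damp]
    simp [r, sub_eq_add_neg])
  have h3 : d y = l • ((r : H →L[ℂ] H) * d x * β r) := by
    rw [hy', hd.map_add, hd.map_one, hd.map_smul, h2, zero_add, smul_neg, neg_smul, neg_neg,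
      Complex.coe_smul]
  have hf1 := hρ.finRank_mul_left r.2 hdx
  have hf2 := hρ.finRank_mul_right (hβM r) hf1
  have h0 := hN.nonneg hρ hdx
  have hl' : (0 : ℝ) ≤ l⁻¹ := by positivity
  rw [h3, hN.apply_smul hρ hl.le hf2]
  calc l * N (r * d x * β r) ≤ l * (l⁻¹ * (l⁻¹ * N (d x))) := by
        refine mul_le_mul_of_nonneg_left ?_ hl.le
        refine (hN.apply_mul_right_le hρ (hβM r) hf1).trans ?_
        refine mul_le_mul ((hβ r).trans hr) ?_ (hN.nonneg hρ hf1) hl'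
        exact (hN.apply_mul_left_le hρ r.2 hdx).trans (mul_le_mul_of_nonneg_right hr h0)
    _ = l⁻¹ * N (d x) := by field_simp

end IsTwistedDerivation

/-! ### Approximately invariant positive contractions -/

section Approx

variable {n : ℕ} {D : Fin n → M.toStarSubalgebra → (H →L[ℂ] H)}

/-- The positive contractions of finite rank with `|D_j(A)|_J ≤ ε`. -/
def almostInvariant (M : VonNeumannAlgebra H) (ρ : (H →L[ℂ] H) → ℝ≥0∞) (N : (H →L[ℂ] H) → ℝ)
    {n : ℕ} (D : Fin n → M.toStarSubalgebra → (H →L[ℂ] H)) (ε : ℝ) : Set M.toStarSubalgebra :=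
  {A | (A : H →L[ℂ] H) ∈ FinRankPosContraction M ρ ∧ ∀ j, N (D j A) ≤ ε}

/-- The weak limits of asymptotically invariant positive contractions of finite rank. -/
def weakInvariant (M : VonNeumannAlgebra H) (ρ : (H →L[ℂ] H) → ℝ≥0∞) (N : (H →L[ℂ] H) → ℝ)
    {n : ℕ} (D : Fin n → M.toStarSubalgebra → (H →L[ℂ] H)) : Set (H →L[ℂ] H) :=
  {X | X ∈ M ∧ 0 ≤ X ∧ X ≤ 1 ∧ ∀ ε : ℝ, 0 < ε → ∀ F : Finset H,
    ∃ A ∈ almostInvariant M ρ N D ε, ∀ ξ ∈ F, ∀ η ∈ F,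
      ‖(inner ℂ (((A : H →L[ℂ] H) - X) ξ) η : ℂ)‖ ≤ ε}

lemma almostInvariant_mono {ε ε' : ℝ} (h : ε ≤ ε') :
    almostInvariant M ρ N D ε ⊆ almostInvariant M ρ N D ε' :=
  fun _ hA => ⟨hA.1, fun j => (hA.2 j).trans h⟩

variable (hD : ∀ j, IsTwistedDerivation M ρ N (D j))
  (hN : IsSymmetricOperatorNorm M ρ N) (hρ : IsFaithfulNormalSemifiniteTrace M ρ)

include hD hN hρ

lemma almostInvariant_convex {ε s t : ℝ} (hs : 0 ≤ s) (ht : 0 ≤ t) (hst : s + t = 1)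
    {A B : M.toStarSubalgebra} (hA : A ∈ almostInvariant M ρ N D ε)
    (hB : B ∈ almostInvariant M ρ N D ε) :
    (s : ℂ) • A + (t : ℂ) • B ∈ almostInvariant M ρ N D ε := by
  obtain ⟨⟨hAf, hA0, hA1⟩, hAN⟩ := hA
  obtain ⟨⟨hBf, hB0, hB1⟩, hBN⟩ := hB
  have hc : (((s : ℂ) • A + (t : ℂ) • B : M.toStarSubalgebra) : H →L[ℂ] H)
      = s • (A : H →L[ℂ] H) + t • (B : H →L[ℂ] H) := by simp
  refine ⟨⟨?_, ?_, ?_⟩, fun j => ?_⟩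
  · exact hρ.finRank_add (hρ.finRank_smul _ hAf) (hρ.finRank_smul _ hBf)
  · rw [hc]
    exact add_nonneg (smul_nonneg_real hs hA0) (smul_nonneg_real ht hB0)
  · rw [hc]
    calc _ ≤ s • (1 : H →L[ℂ] H) + t • (1 : H →L[ℂ] H) :=
          add_le_add (smul_le_smul_of_nonneg_left hA1 hs) (smul_le_smul_of_nonneg_left hB1 ht)
      _ = 1 := by rw [← add_smul, hst, one_smul]
  · have hdA := (hD j).finRank A hAf
    have hdB := (hD j).finRank B hBf
    rw [(hD j).map_add, (hD j).map_smul, (hD j).map_smul]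
    refine (hN.apply_add_le hρ (hρ.finRank_smul _ hdA) (hρ.finRank_smul _ hdB)).trans ?_
    rw [Complex.coe_smul, Complex.coe_smul, hN.apply_smul hρ hs hdA, hN.apply_smul hρ ht hdB]
    calc _ ≤ s * ε + t * ε := add_le_add (mul_le_mul_of_nonneg_left (hAN j) hs)
          (mul_le_mul_of_nonneg_left (hBN j) ht)
      _ = ε := by rw [← add_mul, hst, one_mul]

/-- By convexity, weak approximation can be improved to strong approximation. -/
lemma exists_strong_approx {X : H →L[ℂ] H} (hX : X ∈ weakInvariant M ρ N D) {ε : ℝ} (hε : 0 < ε)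
    (F : Finset H) :
    ∃ A ∈ almostInvariant M ρ N D ε, ∀ ξ ∈ F, ‖((A : H →L[ℂ] H) - X) ξ‖ ≤ ε := by
  classical
  let Φ : (H →L[ℂ] H) → (F → H) := fun A ξ => A ξ
  let s : Set (F → H) := (fun A : M.toStarSubalgebra => Φ A) '' almostInvariant M ρ N D ε
  have hconv : Convex ℝ s := by
    rintro _ ⟨A, hA, rfl⟩ _ ⟨B, hB, rfl⟩ a b ha hb hab
    refine ⟨_, almostInvariant_convex hD hN hρ ha hb hab hA hB, ?_⟩
    funext ξ
    simp [Φ]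
  -- Hahn–Banach separation in `F → H`: a separating functional is a finite sum of inner products
  -- with vectors `w ξ`, so weak approximation tested on `F` and these vectors contradicts the gap
  -- `g`.
  have hmem : Φ X ∈ closure s := by
    by_contra hn
    obtain ⟨f, u, hfu, huf⟩ := RCLike.geometric_hahn_banach_closed_point (𝕜 := ℂ)
      hconv.closure isClosed_closure hn
    let w : F → H := fun ξ => (InnerProductSpace.toDual ℂ H).symm
      (f.comp (ContinuousLinearMap.single ℂ (fun _ : F => H) ξ))
    have hf : ∀ v : F → H, f v = ∑ ξ, inner ℂ (w ξ) (v ξ) := fun v => by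
      conv_lhs => rw [← Finset.univ_sum_single v, map_sum]
      refine Finset.sum_congr rfl fun ξ _ => ?_
      simp [w]
    have hgap : 0 < RCLike.re (f (Φ X)) - u := sub_pos.2 huf
    set g := RCLike.re (f (Φ X)) - u with hg
    obtain ⟨A, hA, hAF⟩ := hX.2.2.2 (min ε (g / (Fintype.card F + 1)))
      (lt_min hε (by positivity)) (F ∪ Finset.univ.image w)
    have hAs : Φ A ∈ closure s :=
      subset_closure ⟨A, almostInvariant_mono (min_le_left _ _) hA, rfl⟩
    have h1 : ‖f (Φ X) - f (Φ A)‖ ≤ Fintype.card F * (g / (Fintype.card F + 1)) := by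
      rw [hf, hf, ← Finset.sum_sub_distrib]
      refine (norm_sum_le _ _).trans ?_
      rw [← nsmul_eq_mul]
      refine Finset.sum_le_card_nsmul _ _ _ fun ξ _ => ?_
      rw [← inner_sub_right, norm_inner_symm, ← norm_neg, ← inner_neg_left, neg_sub]
      exact (hAF ξ (Finset.mem_union_left _ ξ.2) (w ξ) (Finset.mem_union_right _
        (Finset.mem_image_of_mem _ (Finset.mem_univ _)))).trans (min_le_right _ _)
    have h2 : (Fintype.card F : ℝ) * (g / (Fintype.card F + 1)) < g := by
      rw [mul_div_assoc', div_lt_iff₀ (by positivity)]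
      nlinarith
    have h3 := (RCLike.re_le_norm (f (Φ X) - f (Φ A))).trans h1
    rw [map_sub] at h3
    have h4 := hfu _ hAs
    linarith
  obtain ⟨_, ⟨A, hA, rfl⟩, hdist⟩ := Metric.mem_closure_iff.1 hmem ε hε
  refine ⟨A, hA, fun ξ hξ => ?_⟩
  have := ((dist_pi_lt_iff hε).1 hdist ⟨ξ, hξ⟩).le
  rwa [dist_comm, dist_eq_norm] at this

omit hD hN hρ in
-- A diagonal argument with `ε / 2` twice. Stating membership through finite sets of vectors makes
-- this work for arbitrary nets.
lemma weakInvariant_of_weakLim {ι : Type*} {l : Filter ι} [l.NeBot] {X : ι → (H →L[ℂ] H)}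
    {Y : H →L[ℂ] H} (hX : ∀ i, X i ∈ weakInvariant M ρ N D) (hlim : WeakLim l X Y) :
    Y ∈ weakInvariant M ρ N D := by
  refine ⟨hlim.mem fun i => (hX i).1, hlim.nonneg (Eventually.of_forall fun i => (hX i).2.1),
    hlim.le_const (Eventually.of_forall fun i => (hX i).2.2.1), fun ε hε F => ?_⟩
  have h1 : ∀ᶠ i in l, ∀ ξ ∈ F, ∀ η ∈ F, ‖(inner ℂ ((X i - Y) ξ) η : ℂ)‖ < ε / 2 := by
    simp only [eventually_all_finset]
    intro ξ _ η _
    have := ((hlim.sub (WeakLim.const Y)) ξ η).norm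
    simp only [sub_self, zero_apply, inner_zero_left, norm_zero] at this
    exact this.eventually_lt_const (half_pos hε)
  obtain ⟨i, hi⟩ := h1.exists
  obtain ⟨A, hA, hAF⟩ := (hX i).2.2.2 (ε / 2) (half_pos hε) F
  refine ⟨A, almostInvariant_mono (by linarith) hA, fun ξ hξ η hη => ?_⟩
  have : (A : H →L[ℂ] H) - Y = (A - X i) + (X i - Y) := by abel
  rw [this, add_apply, inner_add_left]
  refine (norm_add_le _ _).trans ?_
  linarith [hAF ξ hξ η hη, hi ξ hξ η hη]

omit hD hN hρ in
/-- Weak limits of asymptotically invariant sequences. -/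
lemma weakInvariant_of_tendsto {u : Ultrafilter ℕ}
    {A : ℕ → M.toStarSubalgebra} {X : H →L[ℂ] H}
    (hA : ∀ m, (A m : H →L[ℂ] H) ∈ FinRankPosContraction M ρ)
    (hAN : ∀ ε : ℝ, 0 < ε → ∀ᶠ m in (u : Filter ℕ), ∀ j, N (D j (A m)) ≤ ε)
    (hlim : WeakLim (u : Filter ℕ) (fun m => (A m : H →L[ℂ] H)) X) :
    X ∈ weakInvariant M ρ N D := by
  refine ⟨hlim.mem fun m => (A m).2, hlim.nonneg (Eventually.of_forall fun m => (hA m).2.1),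
    hlim.le_const (Eventually.of_forall fun m => (hA m).2.2), fun ε hε F => ?_⟩
  have h1 : ∀ᶠ m in (u : Filter ℕ), ∀ ξ ∈ F, ∀ η ∈ F,
      ‖(inner ℂ (((A m : H →L[ℂ] H) - X) ξ) η : ℂ)‖ < ε := by
    simp only [eventually_all_finset]
    intro ξ _ η _
    have := ((hlim.sub (WeakLim.const X)) ξ η).norm
    simp only [sub_self, zero_apply, inner_zero_left, norm_zero] at this
    exact this.eventually_lt_const hε
  obtain ⟨m, hm, hm'⟩ := (h1.and (hAN ε hε)).exists
  exact ⟨A m, ⟨hA m, hm'⟩, fun ξ hξ η hη => (hm ξ hξ η hη).le⟩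

lemma weakInvariant_midpoint {X Y : H →L[ℂ] H} (hX : X ∈ weakInvariant M ρ N D)
    (hY : Y ∈ weakInvariant M ρ N D) :
    (2⁻¹ : ℝ) • X + (2⁻¹ : ℝ) • Y ∈ weakInvariant M ρ N D := by
  have h2 : (0 : ℝ) ≤ 2⁻¹ := by norm_num
  refine ⟨add_mem (smul_mem_real hX.1 _) (smul_mem_real hY.1 _),
    add_nonneg (smul_nonneg_real h2 hX.2.1) (smul_nonneg_real h2 hY.2.1), ?_, fun ε hε F => ?_⟩
  · calc _ ≤ (2⁻¹ : ℝ) • (1 : H →L[ℂ] H) + (2⁻¹ : ℝ) • (1 : H →L[ℂ] H) :=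
          add_le_add (smul_le_smul_of_nonneg_left hX.2.2.1 h2)
            (smul_le_smul_of_nonneg_left hY.2.2.1 h2)
      _ = 1 := by rw [← add_smul]; norm_num
  · obtain ⟨A, hA, hAF⟩ := hX.2.2.2 ε hε F
    obtain ⟨B, hB, hBF⟩ := hY.2.2.2 ε hε F
    refine ⟨_, almostInvariant_convex hD hN hρ h2 h2 (by norm_num) hA hB, fun ξ hξ η hη => ?_⟩
    have : (((2⁻¹ : ℝ) : ℂ) • A + ((2⁻¹ : ℝ) : ℂ) • B : M.toStarSubalgebra) -
        ((2⁻¹ : ℝ) • X + (2⁻¹ : ℝ) • Y) =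
        (2⁻¹ : ℂ) • ((A : H →L[ℂ] H) - X) + (2⁻¹ : ℂ) • ((B : H →L[ℂ] H) - Y) := by
      have hc : (((2⁻¹ : ℝ) : ℂ) • A + ((2⁻¹ : ℝ) : ℂ) • B : M.toStarSubalgebra) =
          (2⁻¹ : ℂ) • (A : H →L[ℂ] H) + (2⁻¹ : ℂ) • (B : H →L[ℂ] H) := by simp
      rw [hc, ← Complex.coe_smul, ← Complex.coe_smul, Complex.ofReal_inv, Complex.ofReal_ofNat,
        smul_sub, smul_sub]
      abel
    rw [this, add_apply, smul_apply, smul_apply, inner_add_left, inner_smul_left, inner_smul_left]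
    refine (norm_add_le _ _).trans ?_
    rw [norm_mul, norm_mul]
    have h3 : ‖(starRingEnd ℂ) (2⁻¹ : ℂ)‖ = 2⁻¹ := by simp
    rw [h3]
    linarith [hAF ξ hξ η hη, hBF ξ hξ η hη]

/-- Weak approximation does not survive functional calculus, strong approximation does: in
`damp_sub_damp` the left resolvent is bounded by `l⁻¹`, so it suffices to approximate `X` on the
vectors `resolv l X ξ`. -/
lemma weakInvariant_damp {X : H →L[ℂ] H} (hX : X ∈ weakInvariant M ρ N D) {l : ℝ} (hl : 0 < l) :
    damp l X ∈ weakInvariant M ρ N D := by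
  classical
  refine ⟨damp_mem hX.1, damp_nonneg hl hX.2.1, damp_le_one hl hX.2.1, fun ε hε F => ?_⟩
  set K := ∑ η ∈ F, ‖η‖ with hK
  have hK0 : 0 ≤ K := Finset.sum_nonneg fun _ _ => norm_nonneg _
  have hδ : 0 < min (l * ε) (ε / (K + 1)) := lt_min (by positivity) (by positivity)
  obtain ⟨A, ⟨⟨hAf, hA0, hA1⟩, hAN⟩, hAF⟩ := exists_strong_approx hD hN hρ hX hδ
    (F.image (resolv l X))
  let B : M.toStarSubalgebra := ⟨damp l (A : H →L[ℂ] H), damp_mem A.2⟩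
  refine ⟨B, ⟨⟨?_, damp_nonneg hl hA0, damp_le_one hl hA0⟩, fun j => ?_⟩, fun ξ hξ η hη => ?_⟩
  · change damp l (A : H →L[ℂ] H) ∈ _
    rw [damp_eq_resolv_mul hl hA0]
    exact hρ.finRank_mul_left (resolv_mem A.2) hAf
  · refine ((hD j).apply_damp_le hN hρ hAf hA0 hl rfl).trans ?_
    rw [inv_mul_le_iff₀ hl]
    exact (hAN j).trans (min_le_left _ _)
  · change ‖(inner ℂ ((damp l (A : H →L[ℂ] H) - damp l X) ξ) η : ℂ)‖ ≤ ε
    rw [damp_sub_damp hl hX.2.1 hA0]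
    refine (norm_inner_le_norm _ _).trans ?_
    have h1 : ‖(l • (resolv l (A : H →L[ℂ] H) * ((A : H →L[ℂ] H) - X) * resolv l X)) ξ‖ ≤
        ε / (K + 1) := by
      rw [smul_apply, norm_smul, Real.norm_of_nonneg hl.le, mul_apply_eq_comp, mul_apply_eq_comp]
      calc _ ≤ l * (l⁻¹ * (ε / (K + 1))) := by
            refine mul_le_mul_of_nonneg_left ?_ hl.le
            refine ((resolv l (A : H →L[ℂ] H)).le_opNorm _).trans ?_
            exact mul_le_mul (norm_resolv_le hl hA0)
              ((hAF _ (Finset.mem_image_of_mem _ hξ)).trans (min_le_right _ _))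
              (norm_nonneg _) (by positivity)
        _ = _ := by rw [← mul_assoc, mul_inv_cancel₀ hl.ne', one_mul]
    have h2 : ‖η‖ ≤ K := Finset.single_le_sum (f := fun η => ‖η‖) (fun _ _ => norm_nonneg _) hη
    calc _ ≤ ε / (K + 1) * K := mul_le_mul h1 h2 (norm_nonneg _) (by positivity)
      _ ≤ ε := by
        rw [div_mul_eq_mul_div, div_le_iff₀ (by positivity)]
        nlinarith

/-- The support of a weak limit of asymptotically invariant contractions is again one. -/
lemma weakInvariant_support {X : H →L[ℂ] H} (hX : X ∈ weakInvariant M ρ N D) :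
    ∃ s ∈ Proj M, s ∈ weakInvariant M ρ N D ∧ s * X = X := by
  obtain ⟨s, hs, hsX, -, -, -, u, hu⟩ := exists_support hX.1 hX.2.1
  exact ⟨s, hs, weakInvariant_of_weakLim
    (fun k => weakInvariant_damp hD hN hρ hX (by positivity)) hu, hsX⟩

end Approx

end

section

variable {H : Type*} [NormedAddCommGroup H] [InnerProductSpace ℂ H] [CompleteSpace H]
variable {M : VonNeumannAlgebra H} {ρ : (H →L[ℂ] H) → ℝ≥0∞} {N : (H →L[ℂ] H) → ℝ}

/-! ### The singular projection -/

section Singular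

variable {n : ℕ} {D : Fin n → M.toStarSubalgebra → (H →L[ℂ] H)}

lemma modulus_eq_zero_iff (hρ : IsFaithfulNormalSemifiniteTrace M ρ) {P : H →L[ℂ] H} :
    modulus M ρ N D P = 0 ↔ ∀ P' ∈ FinProj M ρ, P' ≤ P → condenserModulusFin M ρ N D P' 0 = 0 := by
  simp only [modulus, condenserModulus, ENNReal.iSup_eq_zero]
  constructor
  · exact fun h P' hP' hle => h P' hP' 0 hρ.zero_mem_finProj ⟨hle, le_rfl⟩
  · rintro h P' hP' Q' hQ' ⟨hle, hQ⟩
    rw [le_antisymm hQ hQ'.1.2.nonneg]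
    exact h P' hP' hle

variable (hD : ∀ j, IsTwistedDerivation M ρ N (D j))
  (hN : IsSymmetricOperatorNorm M ρ N) (hρ : IsFaithfulNormalSemifiniteTrace M ρ)

include hD hN hρ

lemma exists_uniform_bound : ∃ c : ℝ, 0 ≤ c ∧ ∀ j, ∀ x : M.toStarSubalgebra,
    (x : H →L[ℂ] H) ∈ FinRank M ρ → N (D j x) ≤ c * N x := by
  choose c hc hcN using fun j => (hD j).bound
  refine ⟨∑ j, c j, Finset.sum_nonneg fun j _ => hc j, fun j x hx => (hcN j x hx).trans ?_⟩
  exact mul_le_mul_of_nonneg_right (Finset.single_le_sum (fun j _ => hc j) (Finset.mem_univ j))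
    (hN.nonneg hρ hx)

/-- The modulus vanishes on the finite projections below an asymptotically invariant one. -/
lemma condenserModulusFin_eq_zero [TopologicalSpace.SeparableSpace H] {X P : H →L[ℂ] H}
    (hX : X ∈ weakInvariant M ρ N D) (hP : P ∈ FinProj M ρ) (hPX : P ≤ X) :
    condenserModulusFin M ρ N D P 0 = 0 := by
  classical
  obtain ⟨c, hc, hcN⟩ := exists_uniform_bound hD hN hρ
  have hPp := hP.1.2
  have hXP : X * P = P := mul_proj_of_le hX.2.2.1 hPp hPX
  have key : ∀ ε : ℝ, 0 < ε → condenserModulusFin M ρ N D P 0 ≤ ENNReal.ofReal ε := by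
    intro ε hε
    -- The almost invariant `A` costs `e`, and the correction, of norm at most `2 e`, costs at most
    -- `c * 2 e`.
    set e := ε / (1 + 2 * c) with he
    have he0 : 0 < e := by positivity
    obtain ⟨F, δ, hδ, hF⟩ := hN.exists_finset_apply_mul_le hρ hP he0
    obtain ⟨A, ⟨⟨hAf, hA0, hA1⟩, hAN⟩, hAF⟩ := exists_strong_approx hD hN hρ hX
      (lt_min he0 hδ) (F.image P)
    have h1A0 : 0 ≤ 1 - (A : H →L[ℂ] H) := sub_nonneg.2 hA1
    have h1AM : 1 - (A : H →L[ℂ] H) ∈ M := sub_mem (one_mem M) A.2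
    have hPF := hρ.finProj_mem_finRank hP
    have hf1 : (1 - (A : H →L[ℂ] H)) * P ∈ FinRank M ρ := hρ.finRank_mul_left h1AM hPF
    have hf2 : P * (1 - (A : H →L[ℂ] H)) ∈ FinRank M ρ := hρ.finRank_mul_right h1AM hPF
    have hn1 : N ((1 - (A : H →L[ℂ] H)) * P) ≤ e := by
      refine hF _ h1AM (norm_le_one_of_le h1A0 (sub_le_self 1 hA0)) fun ζ hζ => ?_
      have : (1 - (A : H →L[ℂ] H)) (P ζ) = -(((A : H →L[ℂ] H) - X) (P ζ)) := by
        have h := congrArg (fun T : H →L[ℂ] H => T ζ) hXP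
        simp only [mul_apply_eq_comp] at h
        simp [h]
      rw [this, norm_neg]
      exact (hAF _ (Finset.mem_image_of_mem _ hζ)).trans (min_le_right _ _)
    have hn2 : N (P * (1 - (A : H →L[ℂ] H))) ≤ e := by
      have h := hN.apply_star_le hρ hf1
      rw [star_mul, proj_star hPp, (IsSelfAdjoint.of_nonneg h1A0).star_eq] at h
      exact h.trans hn1
    have h1PM : 1 - P ∈ M := sub_mem (one_mem M) hP.1.1
    have hf3 := hρ.finRank_mul_left h1PM hf1
    -- Chosen so that `A + Cor = P + (1 - P) A (1 - P)`, a positive contraction fixing `P` exactly,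
    -- while each summand contains `(1 - A) P` or its adjoint and is small.
    set Cor := P * (1 - (A : H →L[ℂ] H)) + (1 - P) * ((1 - (A : H →L[ℂ] H)) * P) with hCor
    have hCorf : Cor ∈ FinRank M ρ := hρ.finRank_add hf2 hf3
    have hCorN : N Cor ≤ 2 * e := by
      refine (hN.apply_add_le hρ hf2 hf3).trans ?_
      have h3 := hN.apply_mul_left_le hρ h1PM hf1
      have h4 := mul_le_of_le_one_left (hN.nonneg hρ hf1) (norm_proj_le hPp.one_sub)
      linarith
    let C : M.toStarSubalgebra := ⟨Cor, hCorf.1⟩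
    have hB : ((A + C : M.toStarSubalgebra) : H →L[ℂ] H) =
        P + star (1 - P) * A * (1 - P) := by
      change (A : H →L[ℂ] H) + Cor = _
      rw [hCor, proj_star hPp.one_sub]
      simp only [mul_sub, sub_mul, mul_one, one_mul, mul_assoc, proj_mul_self hPp]
      abel
    refine iInf₂_le_of_le (A + C) ⟨⟨hρ.finRank_add hAf hCorf, ?_, ?_⟩, ?_, mul_zero _⟩
      (iSup_le fun j => ENNReal.ofReal_le_ofReal ?_)
    · rw [hB]
      exact add_nonneg hPp.nonneg (star_left_conjugate_nonneg hA0 _)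
    · rw [hB]
      have h := star_left_conjugate_le_conjugate hA1 (1 - P)
      rw [mul_one, proj_star hPp.one_sub, proj_mul_self hPp.one_sub] at h
      calc _ ≤ P + (1 - P) := add_le_add_right (by rwa [proj_star hPp.one_sub]) P
        _ = 1 := add_sub_cancel _ _
    · rw [hB, add_mul, proj_mul_self hPp, mul_assoc, sub_mul, one_mul, proj_mul_self hPp,
        sub_self, mul_zero, add_zero]
    · rw [(hD j).map_add]
      refine (hN.apply_add_le hρ ((hD j).finRank A hAf) ((hD j).finRank C hCorf)).trans ?_
      have h5 := (hAN j).trans (min_le_left _ _)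
      have h6 := (hcN j C hCorf).trans (mul_le_mul_of_nonneg_left hCorN hc)
      have h7 : e * (1 + 2 * c) = ε := div_mul_cancel₀ _ (by positivity)
      nlinarith
  refine le_antisymm (ENNReal.le_of_forall_pos_le_add fun ε hε _ => ?_) zero_le
  rw [zero_add]
  simpa using key ε hε

omit hD hN hρ in
/-- A finite projection of modulus zero is dominated by a weak limit of asymptotically invariant
contractions. -/
lemma exists_weakInvariant_mul_eq {P : H →L[ℂ] H}
    (h : condenserModulusFin M ρ N D P 0 = 0) :
    ∃ X ∈ weakInvariant M ρ N D, X * P = P := by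
  have hex : ∀ m : ℕ, ∃ A : M.toStarSubalgebra, (A : H →L[ℂ] H) ∈ FinRankPosContraction M ρ ∧
      (A : H →L[ℂ] H) * P = P ∧ ∀ j, N (D j A) ≤ 1 / ((m : ℝ) + 1) := fun m => by
    have hlt : condenserModulusFin M ρ N D P 0 < ENNReal.ofReal (1 / ((m : ℝ) + 1)) := by
      rw [h, ENNReal.ofReal_pos]
      positivity
    simp only [condenserModulusFin, iInf_lt_iff] at hlt
    obtain ⟨A, ⟨hA, hAP, -⟩, hlt⟩ := hlt
    refine ⟨A, hA, hAP, fun j => ?_⟩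
    exact ((ENNReal.ofReal_le_ofReal_iff (by positivity)).1 ((le_iSup _ j).trans hlt.le))
  choose A hA hAP hAN using hex
  have hu := Ultrafilter.of_le (atTop : Filter ℕ)
  obtain ⟨X, hX⟩ := exists_weakLim (Ultrafilter.of (atTop : Filter ℕ))
    (fun m => (A m : H →L[ℂ] H)) (fun m => norm_le_one_of_le (hA m).2.1 (hA m).2.2)
  refine ⟨X, weakInvariant_of_tendsto hA (fun ε hε => hu ?_) hX,
    (hX.mul_const P).eq_const (Eventually.of_forall hAP)⟩
  filter_upwards [(tendsto_one_div_add_atTop_nhds_zero_nat (𝕜 := ℝ)).eventually_lt_const hε]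
    with m hm j
  exact (hAN m j).trans hm.le

lemma zero_mem_weakInvariant : (0 : H →L[ℂ] H) ∈ weakInvariant M ρ N D := by
  refine ⟨zero_mem M, le_rfl, zero_le_one, fun ε hε F => ⟨0, ⟨⟨?_, le_rfl, zero_le_one⟩,
    fun j => ?_⟩, fun ξ _ η _ => ?_⟩⟩
  · exact hρ.finProj_mem_finRank hρ.zero_mem_finProj
  · have := (hD j).map_smul 0 0
    rw [zero_smul, zero_smul] at this
    rw [this, hN.apply_zero hρ]
    exact hε.le
  · simpa using hε.le

/-- The largest asymptotically invariant projection. -/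
lemma exists_greatest_weakInvariant : ∃ E ∈ Proj M, E ∈ weakInvariant M ρ N D ∧
    ∀ X ∈ weakInvariant M ρ N D, E * X = X := by
  let ι := {E : H →L[ℂ] H // E ∈ Proj M ∧ E ∈ weakInvariant M ρ N D}
  have : Nonempty ι := ⟨0, hρ.zero_mem_finProj.1, zero_mem_weakInvariant hD hN hρ⟩
  -- The support of `(E + F) / 2` dominates both projections and stays in the set.
  have : IsDirectedOrder ι := ⟨fun E F => by
    obtain ⟨s, hs, hsw, hsX⟩ := weakInvariant_support hD hN hρ
      (weakInvariant_midpoint hD hN hρ E.2.2 F.2.2)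
    have h2 : (0 : ℝ) ≤ 2⁻¹ := by norm_num
    have hz : (1 - s) * ((2⁻¹ : ℝ) • E.1 + (2⁻¹ : ℝ) • F.1) = 0 := by
      rw [sub_mul, one_mul, hsX, sub_self]
    have hle : ∀ G : ι, (2⁻¹ : ℝ) • G.1 ≤ (2⁻¹ : ℝ) • E.1 + (2⁻¹ : ℝ) • F.1 → G.1 ≤ s :=
      fun G hG => by
        have h := mul_eq_zero_of_le (smul_nonneg_real h2 G.2.1.2.nonneg) hG hz
        rw [mul_smul_comm, smul_eq_zero, sub_mul, one_mul, sub_eq_zero] at h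
        exact (proj_le_iff G.2.1.2 hs.2).2 (h.resolve_left (by norm_num)).symm
    exact ⟨⟨s, hs, hsw⟩, hle E (le_add_of_nonneg_right (smul_nonneg_real h2 F.2.1.2.nonneg)),
      hle F (le_add_of_nonneg_left (smul_nonneg_real h2 E.2.1.2.nonneg))⟩⟩
  obtain ⟨u, E, -, hE, hle, -⟩ := exists_weakLim_of_monotone (fun i : ι => i.1)
    (fun _ _ h => h) (fun i => i.2.1.2.nonneg) (fun i => i.2.1.2.le_one)
  have hEw := weakInvariant_of_weakLim (fun i : ι => i.2.2) hE
  have hEp : IsStarProjection E := by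
    refine ⟨?_, IsSelfAdjoint.of_nonneg hEw.2.1⟩
    exact (hE.const_mul E).unique (hE.congr (Eventually.of_forall fun i =>
      (mul_proj_of_le hEw.2.2.1 i.2.1.2 (hle i)).symm))
  refine ⟨E, ⟨hEw.1, hEp⟩, hEw, fun X hX => ?_⟩
  obtain ⟨s, hs, hsw, hsX⟩ := weakInvariant_support hD hN hρ hX
  have := mul_proj_of_le hEw.2.2.1 hs.2 (hle ⟨s, hs, hsw⟩)
  rw [← hsX, ← mul_assoc, this]

variable [TopologicalSpace.SeparableSpace H]

/-- The greatest asymptotically invariant projection serves. The second clause is kept because the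
convergence statement needs control of all weak limits. -/
lemma exists_singularProjection : ∃ E, IsSingularProjection M ρ N D E ∧
    ∀ X ∈ weakInvariant M ρ N D, E * X = X := by
  obtain ⟨E, hE, hEw, hmax⟩ := exists_greatest_weakInvariant hD hN hρ
  refine ⟨E, ⟨hE, fun P hP => ?_⟩, hmax⟩
  rw [modulus_eq_zero_iff hρ]
  constructor
  · intro h
    refine hρ.le_of_forall_finProj_le hP hE fun P' hP' hle => ?_
    obtain ⟨X, hX, hXP⟩ := exists_weakInvariant_mul_eq (h P' hP' hle)
    rw [proj_le_iff hP'.1.2 hE.2, ← hXP, ← mul_assoc, hmax X hX]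
  · exact fun h P' hP' hle => condenserModulusFin_eq_zero hD hN hρ hEw hP' (hle.trans h)

omit hD hN hρ [TopologicalSpace.SeparableSpace H] in
lemma IsSingularProjection.unique {E E' : H →L[ℂ] H} (h : IsSingularProjection M ρ N D E)
    (h' : IsSingularProjection M ρ N D E') : E = E' :=
  le_antisymm ((h'.2 E h.1).1 ((h.2 E h.1).2 le_rfl)) ((h.2 E' h'.1).1 ((h'.2 E' h'.1).2 le_rfl))

/-- Bounded selfadjoint asymptotically invariant sequences of finite rank operators tend strongly
to zero on the regular part. -/
lemma tendsto_regular {E : H →L[ℂ] H} (hE : IsSingularProjection M ρ N D E)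
    {A : ℕ → M.toStarSubalgebra} (hAf : ∀ m, (A m : H →L[ℂ] H) ∈ FinRank M ρ)
    (hAs : ∀ m, IsSelfAdjoint (A m : H →L[ℂ] H)) {C : ℝ} (hAC : ∀ m, ‖(A m : H →L[ℂ] H)‖ ≤ C)
    (hAN : Tendsto (fun m => ⨆ j, N (D j (A m))) atTop (𝓝 0)) (ξ : H) :
    Tendsto (fun m => (A m : H →L[ℂ] H) ((1 - E) ξ)) atTop (𝓝 0) := by
  obtain ⟨E', hE', hmax⟩ := exists_singularProjection hD hN hρ
  obtain rfl := hE.unique hE'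
  -- The maximum with `1` makes `K` positive and gives `‖A m‖ ≤ K ≤ K ^ 2`, so `A m ^ 2 / K ^ 2` is
  -- a contraction and the factor `‖A m‖` from squaring is absorbed.
  set K := max C 1 with hK
  have hK0 : 0 < K := lt_max_of_lt_right one_pos
  have hAK : ∀ m, ‖(A m : H →L[ℂ] H)‖ ≤ K := fun m => (hAC m).trans (le_max_left _ _)
  have hc0 : (0 : ℝ) ≤ (K ^ 2)⁻¹ := by positivity
  let B : ℕ → M.toStarSubalgebra := fun m => (((K ^ 2)⁻¹ : ℝ) : ℂ) • (A m * A m)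
  have hBc : ∀ m, (B m : H →L[ℂ] H) =
      (K ^ 2)⁻¹ • (star (A m : H →L[ℂ] H) * (A m : H →L[ℂ] H)) := fun m => by
    rw [(hAs m).star_eq, ← Complex.coe_smul]
    rfl
  have hAAf : ∀ m, ((A m * A m : M.toStarSubalgebra) : H →L[ℂ] H) ∈ FinRank M ρ := fun m =>
    hρ.finRank_mul_left (A m).2 (hAf m)
  have hB : ∀ m, (B m : H →L[ℂ] H) ∈ FinRankPosContraction M ρ := fun m => by
    have h0 : 0 ≤ (B m : H →L[ℂ] H) := by
      rw [hBc]
      exact smul_nonneg_real hc0 (star_mul_self_nonneg _)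
    refine ⟨hρ.finRank_smul _ (hAAf m), h0, le_one_of_norm_le h0 ?_⟩
    rw [hBc, norm_smul, CStarRing.norm_star_mul_self, Real.norm_of_nonneg hc0,
      inv_mul_le_iff₀ (by positivity), mul_one, sq]
    exact mul_le_mul (hAK m) (hAK m) (norm_nonneg _) hK0.le
  have hBN : ∀ m j, N (D j (B m)) ≤ 2 * (⨆ j, N (D j (A m))) := fun m j => by
    rw [(hD j).map_smul, Complex.coe_smul, hN.apply_smul hρ hc0 ((hD j).finRank _ (hAAf m)),
      inv_mul_le_iff₀ (by positivity)]
    have h1 := (hD j).apply_mul_self_le hN hρ (hAf m)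
    have h2 : N (D j (A m)) ≤ ⨆ j, N (D j (A m)) := 
      le_ciSup (f := fun j => N (D j (A m))) (Set.finite_range _).bddAbove j
    have h3 := hN.nonneg hρ ((hD j).finRank _ (hAf m))
    have h4 : ‖(A m : H →L[ℂ] H)‖ ≤ K ^ 2 := (hAK m).trans (by
      have : 1 ≤ K := le_max_right _ _
      nlinarith)
    have h5 : ‖(A m : H →L[ℂ] H)‖ * N (D j (A m)) ≤ K ^ 2 * ⨆ j, N (D j (A m)) :=
      mul_le_mul h4 h2 h3 (by positivity)
    linarith
  have hBlim : Tendsto (fun m => 2 * (⨆ j, N (D j (A m)))) atTop (𝓝 0) := by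
    simpa using hAN.const_mul 2
  set η := (1 - E) ξ with hη
  have hmain : Tendsto (fun m => (inner ℂ ((B m : H →L[ℂ] H) η) η : ℂ).re) atTop (𝓝 0) := by
    -- Along every ultrafilter the bounded sequence `B` has a weak limit; that limit lies in
    -- `weakInvariant`, so it is supported by `E` and kills `η`.
    rw [tendsto_iff_ultrafilter]
    intro u hu
    obtain ⟨X, hX⟩ := exists_weakLim u (fun m => (B m : H →L[ℂ] H))
      (fun m => norm_le_one_of_le (hB m).2.1 (hB m).2.2)
    have hXw : X ∈ weakInvariant M ρ N D := weakInvariant_of_tendsto hB (fun ε hε => hu (by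
      filter_upwards [hBlim.eventually_lt_const hε] with m hm j
      exact (hBN m j).trans hm.le)) hX
    have hXE : X * (1 - E) = 0 := by
      have h := congrArg star (hmax X hXw)
      rw [star_mul, proj_star hE.1.2, (IsSelfAdjoint.of_nonneg hXw.2.1).star_eq] at h
      rw [mul_sub, mul_one, h, sub_self]
    have hXη : X η = 0 := by
      rw [hη, ← mul_apply_eq_comp, hXE, zero_apply]
    simpa [hXη] using hX.re_inner η
  rw [tendsto_zero_iff_norm_tendsto_zero]
  have hsq : ∀ m, ‖(A m : H →L[ℂ] H) η‖ =
      √(K ^ 2 * (inner ℂ ((B m : H →L[ℂ] H) η) η : ℂ).re) := fun m => by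
    have h1 : (inner ℂ ((B m : H →L[ℂ] H) η) η : ℂ).re =
        (K ^ 2)⁻¹ * ‖(A m : H →L[ℂ] H) η‖ ^ 2 := by
      rw [hBc, ← re_inner_star_mul_self, smul_apply, ← Complex.coe_smul, inner_smul_left,
        Complex.conj_ofReal, Complex.re_ofReal_mul]
    rw [h1, ← mul_assoc, mul_inv_cancel₀ (by positivity), one_mul, Real.sqrt_sq (norm_nonneg _)]
  simp_rw [hsq]
  simpa using (hmain.const_mul (K ^ 2)).sqrt

end Singular

/-! ### Commutators and automorphisms -/

section Instances

variable (hN : IsSymmetricOperatorNorm M ρ N) (hρ : IsFaithfulNormalSemifiniteTrace M ρ)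
include hN hρ

lemma isTwistedDerivation_commDiff {n : ℕ} (T : Fin n → M.toStarSubalgebra) (j : Fin n) :
    IsTwistedDerivation M ρ N (commDiff M T j) where
  finRank x hx := hρ.finRank_sub (hρ.finRank_mul_left (T j).2 hx) (hρ.finRank_mul_right (T j).2 hx)
  map_add x y := by
    simp only [commDiff, AddMemClass.coe_add, mul_add, add_mul]
    abel
  map_smul c x := by
    change (T j : H →L[ℂ] H) * (c • (x : H →L[ℂ] H)) - (c • (x : H →L[ℂ] H)) * T j = _
    rw [mul_smul_comm, smul_mul_assoc, ← smul_sub]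
    rfl
  map_one := by simp [commDiff]
  bound := by
    refine ⟨2 * ‖(T j : H →L[ℂ] H)‖, by positivity, fun x hx => ?_⟩
    refine (hN.apply_sub_le hρ (hρ.finRank_mul_left (T j).2 hx)
      (hρ.finRank_mul_right (T j).2 hx)).trans ?_
    linarith [hN.apply_mul_left_le hρ (T j).2 hx, hN.apply_mul_right_le hρ (T j).2 hx]
  leibniz := by
    refine ⟨fun x => x, fun x => x.2, fun _ => le_rfl, fun _ _ => rfl, rfl, fun x y => ?_⟩
    simp only [commDiff, MulMemClass.coe_mul, mul_sub, sub_mul, mul_assoc]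
    abel

omit hN hρ in
-- `M` is norm closed, hence a C*-algebra, and *-homomorphisms of C*-algebras are contractive.
lemma norm_starAlgEquiv_le (α : M.toStarSubalgebra ≃⋆ₐ[ℂ] M.toStarSubalgebra)
    (x : M.toStarSubalgebra) : ‖(α x : H →L[ℂ] H)‖ ≤ ‖(x : H →L[ℂ] H)‖ := by
  have hcl : IsClosed (M.toStarSubalgebra : Set (H →L[ℂ] H)) := isClosed_vonNeumann
  let _ : CStarAlgebra M.toStarSubalgebra :=
    StarSubalgebra.cstarAlgebra M.toStarSubalgebra (h_closed := hcl)
  exact NonUnitalStarAlgHom.norm_apply_le α x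

omit hN in
lemma starAlgEquiv_finProj (α : M.toStarSubalgebra ≃⋆ₐ[ℂ] M.toStarSubalgebra)
    (hα : ∀ x : M.toStarSubalgebra, 0 ≤ (x : H →L[ℂ] H) → ρ (α x) = ρ x)
    {P : M.toStarSubalgebra} (hP : (P : H →L[ℂ] H) ∈ FinProj M ρ) :
    (α P : H →L[ℂ] H) ∈ FinProj M ρ := by
  refine ⟨⟨(α P).2, ?_, ?_⟩, ?_⟩
  · have h : P * P = P := Subtype.ext (proj_mul_self hP.1.2)
    have h' := congrArg α h
    rw [map_mul] at h'
    exact congrArg Subtype.val h'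
  · have h : star P = P := Subtype.ext (proj_star hP.1.2)
    have h' := congrArg α h
    rw [map_star] at h'
    exact congrArg Subtype.val h'
  · rw [hα P hP.1.2.nonneg]
    exact hP.2

omit hN in
lemma starAlgEquiv_finRank (α : M.toStarSubalgebra ≃⋆ₐ[ℂ] M.toStarSubalgebra)
    (hα : ∀ x : M.toStarSubalgebra, 0 ≤ (x : H →L[ℂ] H) → ρ (α x) = ρ x)
    {x : M.toStarSubalgebra} (hx : (x : H →L[ℂ] H) ∈ FinRank M ρ) :
    (α x : H →L[ℂ] H) ∈ FinRank M ρ := by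
  obtain ⟨hxM, P, hP, hxP⟩ := hx
  let P' : M.toStarSubalgebra := ⟨P, hP.1.1⟩
  refine ⟨(α x).2, α P', starAlgEquiv_finProj hρ α hα (P := P') hP, ?_⟩
  have h : x * P' = x := Subtype.ext hxP
  have h' := congrArg α h
  rw [map_mul] at h'
  exact congrArg Subtype.val h'

lemma apply_starAlgEquiv_le (α : M.toStarSubalgebra ≃⋆ₐ[ℂ] M.toStarSubalgebra)
    (hα : ∀ x : M.toStarSubalgebra, 0 ≤ (x : H →L[ℂ] H) → ρ (α x) = ρ x)
    {x : M.toStarSubalgebra} (hx : (x : H →L[ℂ] H) ∈ FinRank M ρ) : N (α x) ≤ N x := by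
  refine hN.mono _ (hρ.finRank_subset (starAlgEquiv_finRank hρ α hα hx)) _
    (hρ.finRank_subset hx) fun t _ => hρ.singularValue_le fun P hP => ?_
  let P' : M.toStarSubalgebra := ⟨P, hP.1.1⟩
  refine ⟨α P', starAlgEquiv_finProj hρ α hα (P := P') hP, (hα P' hP.1.2.nonneg).le, ?_⟩
  have h := norm_starAlgEquiv_le α (x * (1 - P'))
  rw [map_mul, map_sub, map_one] at h
  exact h

lemma isTwistedDerivation_autDiff {n : ℕ}
    (α : Fin n → (M.toStarSubalgebra ≃⋆ₐ[ℂ] M.toStarSubalgebra))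
    (hα : ∀ j, ∀ x : M.toStarSubalgebra, 0 ≤ (x : H →L[ℂ] H) → ρ (α j x) = ρ x) (j : Fin n) :
    IsTwistedDerivation M ρ N (autDiff M α j) where
  finRank x hx := hρ.finRank_sub (starAlgEquiv_finRank hρ (α j) (hα j) hx) hx
  map_add x y := by
    simp only [autDiff, map_add, AddMemClass.coe_add]
    abel
  map_smul c x := by
    simp only [autDiff, map_smul]
    exact (smul_sub c (α j x : H →L[ℂ] H) x).symm
  map_one := by simp [autDiff]
  bound := by
    refine ⟨2, by norm_num, fun x hx => ?_⟩
    refine (hN.apply_sub_le hρ (starAlgEquiv_finRank hρ (α j) (hα j) hx) hx).trans ?_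
    linarith [apply_starAlgEquiv_le hN hρ (α j) (hα j) hx]
  leibniz := by
    refine ⟨fun x => α j x, fun x => (α j x).2, norm_starAlgEquiv_le (α j), fun x y => ?_, ?_,
      fun x y => ?_⟩
    · exact congrArg Subtype.val (map_mul (α j) x y)
    · exact congrArg Subtype.val (map_one (α j))
    · simp only [autDiff, map_mul, MulMemClass.coe_mul, mul_sub, sub_mul]
      abel

end Instances

end

end SemifiniteModulus

end

open SemifiniteModulus in
theorem proposition6p4 {H : Type*} [NormedAddCommGroup H] [InnerProductSpace ℂ H]
    [CompleteSpace H] [TopologicalSpace.SeparableSpace H]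
    (M : VonNeumannAlgebra H) (ρ : (H →L[ℂ] H) → ℝ≥0∞)
    (hρ : IsFaithfulNormalSemifiniteTrace M ρ)
    (hM : IsAtomic M ∨ (IsDiffuse M ∧ ρ 1 = ∞))
    (N : (H →L[ℂ] H) → ℝ) (hN : IsSymmetricOperatorNorm M ρ N) (n : ℕ) :
    (∀ T : Fin n → M.toStarSubalgebra,
      (∃! E₀, IsSingularProjection M ρ N (commDiff M T) E₀) ∧
      ∀ E₀, IsSingularProjection M ρ N (commDiff M T) E₀ →
        ∀ A : ℕ → M.toStarSubalgebra,
          (∀ m, (A m : H →L[ℂ] H) ∈ FinRank M ρ) → (∀ m, IsSelfAdjoint (A m : H →L[ℂ] H)) →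
          (∃ C : ℝ, ∀ m, ‖(A m : H →L[ℂ] H)‖ ≤ C) →
          Tendsto (fun m => ⨆ j, N ((A m : H →L[ℂ] H) * T j - T j * A m)) atTop (𝓝 0) →
          ∀ ξ : H, Tendsto (fun m => (A m : H →L[ℂ] H) ((1 - E₀) ξ)) atTop (𝓝 0)) ∧
    (∀ α : Fin n → (M.toStarSubalgebra ≃⋆ₐ[ℂ] M.toStarSubalgebra),
      (∀ j, ∀ x : M.toStarSubalgebra, 0 ≤ (x : H →L[ℂ] H) →
        ρ (α j x : H →L[ℂ] H) = ρ (x : H →L[ℂ] H)) →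
      (∃! E₀, IsSingularProjection M ρ N (autDiff M α) E₀) ∧
      ∀ E₀, IsSingularProjection M ρ N (autDiff M α) E₀ →
        ∀ A : ℕ → M.toStarSubalgebra,
          (∀ m, (A m : H →L[ℂ] H) ∈ FinRank M ρ) → (∀ m, IsSelfAdjoint (A m : H →L[ℂ] H)) →
          (∃ C : ℝ, ∀ m, ‖(A m : H →L[ℂ] H)‖ ≤ C) →
          Tendsto (fun m => ⨆ j, N ((α j (A m) : H →L[ℂ] H) - A m)) atTop (𝓝 0) →
          ∀ ξ : H, Tendsto (fun m => (A m : H →L[ℂ] H) ((1 - E₀) ξ)) atTop (𝓝 0)) := by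
  refine ⟨fun T => ?_, fun α hα => ?_⟩
  · have hD := isTwistedDerivation_commDiff hN hρ T
    obtain ⟨E, hE, -⟩ := exists_singularProjection hD hN hρ
    refine ⟨⟨E, hE, fun E' hE' => hE'.unique hE⟩, ?_⟩
    rintro E₀ hE₀ A hAf hAs ⟨C, hAC⟩ hAN ξ
    refine tendsto_regular hD hN hρ hE₀ hAf hAs hAC (hAN.congr fun m => iSup_congr fun j => ?_) ξ
    -- The hypothesis concerns `[A, T]` and `commDiff` is `[T, A]`; the norm ignores the sign.
    rw [← hN.apply_neg hρ ((hD j).finRank _ (hAf m)), commDiff, neg_sub]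
  · have hD := isTwistedDerivation_autDiff hN hρ α hα
    obtain ⟨E, hE, -⟩ := exists_singularProjection hD hN hρ
    refine ⟨⟨E, hE, fun E' hE' => hE'.unique hE⟩, ?_⟩
    rintro E₀ hE₀ A hAf hAs ⟨C, hAC⟩ hAN ξ
    exact tendsto_regular hD hN hρ hE₀ hAf hAs hAC hAN ξ
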